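/- Let $k$ be an algebraically closed field, let $(\Delta,\mathfrak R)$ be a bound quiver ($\Delta$ a finite quiver with vertex set $\Delta_0$, arrow set $\Delta_1$ and source and target maps $s,t\colon\Delta_1\to\Delta_0$; $\mathfrak R$ a minimal set of relations, each of which is a linear combination of paths of length at least $2$ with common source and common target, such that all sufficiently long paths lie in the two-sided ideal $\langle\mathfrak R\rangle$ of the path algebra $k\Delta$), and let $\Lambda=k\Delta/\langle\mathfrak R\rangle$. For a dimension vector $\mathbf d\in\mathbb N^{\Delta_0}$ let $\mathrm{mod}_\Lambda^{\mathbf d}$ be the affine scheme whose $R$-points, for a commutative $k$-algebra $R$, are the families $M=(M_\alpha)_{\alpha\in\Delta_1}$ of matrices $M_\alpha\in \mathbb M_{d(t\alpha)\times d(s\alpha)}(R)$ with $M_\rho=0$ for all $\rho\in\mathfrak R$ (here $M_\rho$ is obtained from $\rho$ by substituting $M_\alpha$ for each arrow $\alpha$). The group scheme $\mathrm{GL}_{\mathbf d}=\prod_{x\in\Delta_0}\mathrm{GL}_{d(x)}$ acts by $(g*M)_\alpha=g_{t\alpha}M_\alpha g_{s\alpha}^{-1}$. Let $\mathbf d_1,\mathbf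 d_2$ be dimension vectors, $\mathbf d=\mathbf d_1+\mathbf d_2$, $U\in\mathrm{mod}_\Lambda^{\mathbf d_1}(k)$, $V\in\mathrm{mod}_\Lambda^{\mathbf d_2}(k)$, and let $N=U\oplus V\in\mathrm{mod}_\Lambda^{\mathbf d}(k)$ be given by the block matrices $\begin{bmatrix}U_\alpha&0\\0&V_\alpha\end{bmatrix}$. Let $\mathcal E_\Lambda^{\mathbf d_2,\mathbf d_1}\subseteq\mathrm{mod}_\Lambda^{\mathbf d}$ be the closed subscheme of those $M$ for which every $M_\alpha$ is block upper triangular, i.e. of the form $\begin{bmatrix}*&*\\0&*\end{bmatrix}$ with respect to $\mathbf d=\mathbf d_1+\mathbf d_2$. Let $\mathbb B^{U,V}$ be the space of all families $(h_{t\alpha}U_\alpha-V_\alpha h_{s\alpha})_{\alpha\in\Delta_1}$ with $h\in\prod_{x\in\Delta_0}\mathbb M_{d_2(x)\times d_1(x)}(k)$. Let $\mathcal Z$ be a $\mathrm{GL}_{\mathbf d}(k)$-invariant irreducible Zariski closed subset of $\mathrm{mod}_\Lambda^{\mathbf d}(k)$ with $N\in\mathcal Z$, regarded as an affine scheme with its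 reduced structure, and let $\mathcal Z\cap\mathcal E_\Lambda^{\mathbf d_2,\mathbf d_1}$ denote the scheme-theoretic intersection. If $\mathrm{Ext}^1_\Lambda(U,V)=0$, then the action map $$\mathrm{GL}_{\mathbf d}\times(\mathcal Z\cap\mathcal E_\Lambda^{\mathbf d_2,\mathbf d_1})\to\mathcal Z,\qquad (g,M)\mapsto g*M,$$ is smooth at $(\mathrm{Id},N)$. Moreover, the scheme $\mathcal Z\cap\mathcal E_\Lambda^{\mathbf d_2,\mathbf d_1}$ is reduced at $N$, and $$\dim_k T_N\mathcal Z=\dim_k T_N(\mathcal Z\cap\mathcal E_\Lambda^{\mathbf d_2,\mathbf d_1})+\dim_k\mathbb B^{U,V}.$$ -/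

import Mathlib

universe u v w

open scoped TensorProduct

noncomputable section

namespace QuiverRep

/-! ### Path algebras of quivers -/

/-- The path algebra `kΔ` of a quiver with finite vertex set. An element is the family of its
components `f x y ∈ 1_x (kΔ) 1_y`, where `f x y` is a `k`-linear combination of paths
starting in `y` and terminating in `x`. -/
def PathAlgebra (k : Type u) (Δ : Type v) [Field k] [Quiver.{w} Δ] :=
  ∀ x y : Δ, Quiver.Path y x →₀ k

section PathAlgebra

variable {k : Type u} {Δ : Type v} [Field k] [Quiver.{w} Δ]

instance : AddCommGroup (PathAlgebra k Δ) :=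
  inferInstanceAs (AddCommGroup (∀ x y : Δ, Quiver.Path y x →₀ k))

instance : Module k (PathAlgebra k Δ) :=
  inferInstanceAs (Module k (∀ x y : Δ, Quiver.Path y x →₀ k))

/-- Bilinear extension of the composition of paths: a path `p` from `y` to `x` and a path `q`
from `z` to `y` are sent to the path `p q` (first `q`, then `p`) from `z` to `x`. -/
def pathComp {x y z : Δ} : (Quiver.Path y x →₀ k) →ₗ[k] (Quiver.Path z y →₀ k) →ₗ[k]
    (Quiver.Path z x →₀ k) :=
  Finsupp.linearCombination k fun p => Finsupp.lmapDomain k k fun q => q.comp p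

lemma pathComp_single {x y z : Δ} (p : Quiver.Path y x) (q : Quiver.Path z y) (a b : k) :
    pathComp (Finsupp.single p a) (Finsupp.single q b) = Finsupp.single (q.comp p) (a * b) := by
  simp [pathComp, Finsupp.mapDomain_single]

lemma pathComp_assoc {x y z t : Δ} (f : Quiver.Path y x →₀ k) (g : Quiver.Path z y →₀ k)
    (h : Quiver.Path t z →₀ k) : pathComp (pathComp f g) h = pathComp f (pathComp g h) := by
  induction f using Finsupp.induction_linear with
  | zero => simp
  | add f₁ f₂ h₁ h₂ => simp [h₁, h₂]
  | single p a =>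
    induction g using Finsupp.induction_linear with
    | zero => simp
    | add f₁ f₂ h₁ h₂ => simp [h₁, h₂]
    | single q b =>
      induction h using Finsupp.induction_linear with
      | zero => simp
      | add f₁ f₂ h₁ h₂ => simp [h₁, h₂]
      | single r c => simp only [pathComp_single, mul_assoc, Quiver.Path.comp_assoc]

lemma pathComp_nil_left {x z : Δ} (g : Quiver.Path z x →₀ k) :
    pathComp (Finsupp.single Quiver.Path.nil 1) g = g := by
  induction g using Finsupp.induction_linear with
  | zero => simp
  | add f₁ f₂ h₁ h₂ => simp [h₁, h₂]
  | single q b => simp [pathComp_single]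

lemma pathComp_nil_right {x z : Δ} (g : Quiver.Path z x →₀ k) :
    pathComp g (Finsupp.single Quiver.Path.nil 1) = g := by
  induction g using Finsupp.induction_linear with
  | zero => simp
  | add f₁ f₂ h₁ h₂ => simp [h₁, h₂]
  | single q b => simp [pathComp_single]

open Classical in
instance : One (PathAlgebra k Δ) :=
  ⟨fun x => Pi.single (M := fun y : Δ => Quiver.Path y x →₀ k) x
    (Finsupp.single Quiver.Path.nil 1)⟩

lemma PathAlgebra.add_apply (f g : PathAlgebra k Δ) (x z : Δ) :
    (f + g) x z = f x z + g x z := rfl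

lemma PathAlgebra.smul_apply (c : k) (f : PathAlgebra k Δ) (x z : Δ) :
    (c • f) x z = c • f x z := rfl

lemma PathAlgebra.one_apply_self (x : Δ) :
    (1 : PathAlgebra k Δ) x x = Finsupp.single Quiver.Path.nil 1 := by
  classical
  exact Pi.single_eq_same (M := fun y : Δ => Quiver.Path y x →₀ k) x _

lemma PathAlgebra.one_apply_ne {x y : Δ} (h : y ≠ x) : (1 : PathAlgebra k Δ) x y = 0 := by
  classical
  exact Pi.single_eq_of_ne (M := fun y : Δ => Quiver.Path y x →₀ k) h _

variable [Fintype Δ]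

instance : Mul (PathAlgebra k Δ) := ⟨fun f g x z => ∑ y, pathComp (f x y) (g y z)⟩

lemma PathAlgebra.mul_apply (f g : PathAlgebra k Δ) (x z : Δ) :
    (f * g) x z = ∑ y, pathComp (f x y) (g y z) := rfl

instance : Ring (PathAlgebra k Δ) :=
  { (inferInstance : AddCommGroup (PathAlgebra k Δ)) with
    mul := (· * ·)
    one := 1
    left_distrib := fun f g h => by
      funext x z
      simp [PathAlgebra.mul_apply, PathAlgebra.add_apply, Finset.sum_add_distrib]
    right_distrib := fun f g h => by
      funext x z
      simp [PathAlgebra.mul_apply, PathAlgebra.add_apply, Finset.sum_add_distrib]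
    zero_mul := fun f => by
      funext x z
      change ∑ y, pathComp 0 (f y z) = 0
      simp
    mul_zero := fun f => by
      funext x z
      change ∑ y, pathComp (f x y) 0 = 0
      simp
    mul_assoc := fun f g h => by
      funext x z
      simp only [PathAlgebra.mul_apply, map_sum, LinearMap.sum_apply, pathComp_assoc]
      exact Finset.sum_comm
    one_mul := fun f => by
      funext x z
      rw [PathAlgebra.mul_apply, Finset.sum_eq_single x]
      · rw [PathAlgebra.one_apply_self, pathComp_nil_left]
      · intro y _ hy
        rw [PathAlgebra.one_apply_ne hy]
        simp
      · simp
    mul_one := fun f => by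
      funext x z
      rw [PathAlgebra.mul_apply, Finset.sum_eq_single z]
      · rw [PathAlgebra.one_apply_self, pathComp_nil_right]
      · intro y _ hy
        rw [PathAlgebra.one_apply_ne hy.symm]
        simp
      · simp }

instance : Algebra k (PathAlgebra k Δ) :=
  Algebra.ofModule
    (fun c f g => by
      funext x z
      simp [PathAlgebra.mul_apply, PathAlgebra.smul_apply, Finset.smul_sum])
    (fun c f g => by
      funext x z
      simp [PathAlgebra.mul_apply, PathAlgebra.smul_apply, Finset.smul_sum])

open Classical in
/-- The path `p` as an element of the path algebra. -/
def ofPath (k : Type u) {Δ : Type v} [Field k] [Quiver.{w} Δ] {x y : Δ} (p : Quiver.Path y x) :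
    PathAlgebra k Δ :=
  Pi.single (M := fun x : Δ => ∀ y : Δ, Quiver.Path y x →₀ k) x
    (Pi.single (M := fun y : Δ => Quiver.Path y x →₀ k) y (Finsupp.single p 1))

/-- `ρ` is a relation: it lies in `1_x (kΔ) 1_y` for some vertices `x`, `y`, and it is a linear
combination of paths of length greater than one. -/
def IsRelation (ρ : PathAlgebra k Δ) : Prop :=
  (∃ x y : Δ, ofPath k (Quiver.Path.nil : Quiver.Path x x) * ρ *
      ofPath k (Quiver.Path.nil : Quiver.Path y y) = ρ) ∧
    ∀ x y : Δ, ∀ p ∈ (ρ x y).support, 1 < p.length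

end PathAlgebra

/-- A bound quiver `(Δ, 𝔯)`: a minimal set of relations such that all sufficiently long paths
lie in the two-sided ideal generated by it. -/
structure BoundQuiver (k : Type u) (Δ : Type v) [Field k] [Quiver.{w} Δ] [Fintype Δ] where
  /-- the set `𝔯` of relations -/
  rels : Set (PathAlgebra k Δ)
  isRelation : ∀ ρ ∈ rels, IsRelation ρ
  minimal : ∀ ρ ∈ rels, ρ ∉ TwoSidedIdeal.span (rels \ {ρ})
  exists_bound : ∃ n : ℕ, 0 < n ∧ ∀ (x y : Δ) (p : Quiver.Path y x), n ≤ p.length →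
    ofPath k p ∈ TwoSidedIdeal.span rels

/-- The path algebra `Λ = kΔ / ⟨𝔯⟩` of a bound quiver. -/
abbrev BoundQuiver.Alg {k : Type u} {Δ : Type v} [Field k] [Quiver.{w} Δ] [Fintype Δ]
    (B : BoundQuiver k Δ) : Type max u v w :=
  PathAlgebra k Δ ⧸ (TwoSidedIdeal.span B.rels).asIdeal

/-! ### Representations and modules -/

/-- `𝔸^{d₁,d₂}(R)`: families of `d₂(tα) × d₁(sα)`-matrices indexed by the arrows `α`. -/
abbrev ArrowSpace {Δ : Type v} [Quiver.{w} Δ] (R : Type*) (d₁ d₂ : Δ → ℕ) :=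
  ∀ (a b : Δ), (a ⟶ b) → Matrix (Fin (d₂ b)) (Fin (d₁ a)) R

/-- `𝕍^{d₁,d₂}(R)`: families of `d₂(x) × d₁(x)`-matrices indexed by the vertices `x`. -/
abbrev VertexSpace {Δ : Type v} (R : Type*) (d₁ d₂ : Δ → ℕ) :=
  ∀ x : Δ, Matrix (Fin (d₂ x)) (Fin (d₁ x)) R

section Representations

variable {k : Type u} {Δ : Type v} [Field k] [Quiver.{w} Δ]
variable {R : Type*} [CommRing R] [Algebra k R] {d : Δ → ℕ}

/-- The matrix `M_σ` of a path `σ`: the product of the matrices of its arrows. -/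
def pathMatrix (M : ArrowSpace R d d) {y : Δ} :
    ∀ {x : Δ}, Quiver.Path y x → Matrix (Fin (d x)) (Fin (d y)) R
  | _, .nil => 1
  | _, .cons p α => M _ _ α * pathMatrix M p

/-- `k`-linear extension of `σ ↦ M_σ` to combinations of paths from `y` to `x`. -/
def combMatrix (M : ArrowSpace R d d) (x y : Δ) :
    (Quiver.Path y x →₀ k) →ₗ[k] Matrix (Fin (d x)) (Fin (d y)) R :=
  Finsupp.linearCombination k fun p => pathMatrix M p

lemma pathMatrix_comp (M : ArrowSpace R d d) {x y z : Δ} (q : Quiver.Path z y)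
    (p : Quiver.Path y x) : pathMatrix M (q.comp p) = pathMatrix M p * pathMatrix M q := by
  induction p with
  | nil => simp [pathMatrix]
  | cons p α ih => simp [pathMatrix, ih, Matrix.mul_assoc]

lemma combMatrix_pathComp (M : ArrowSpace R d d) {x y z : Δ} (f : Quiver.Path y x →₀ k)
    (g : Quiver.Path z y →₀ k) :
    combMatrix M x z (pathComp f g) = combMatrix M x y f * combMatrix M y z g := by
  induction f using Finsupp.induction_linear with
  | zero => simp
  | add f₁ f₂ h₁ h₂ => simp [h₁, h₂, Matrix.add_mul]
  | single p a =>
    induction g using Finsupp.induction_linear with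
    | zero => simp
    | add f₁ f₂ h₁ h₂ => simp [h₁, h₂, Matrix.mul_add]
    | single q b =>
      simp only [pathComp_single, combMatrix, Finsupp.linearCombination_single, pathMatrix_comp]
      rw [Matrix.smul_mul, Matrix.mul_smul, smul_smul]

variable [Fintype Δ]

/-- `M` is an `R`-representation of the bound quiver: `M_ρ = 0` for every relation `ρ`. -/
def BoundQuiver.IsRep (B : BoundQuiver k Δ) (M : ArrowSpace R d d) : Prop :=
  ∀ ρ ∈ B.rels, ∀ x y : Δ, combMatrix M x y (ρ x y) = 0

/-- The action of the path algebra `kΔ` on `⨁_x k^{d(x)}` given by a representation. -/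
def pathAction (M : ArrowSpace k d d) :
    PathAlgebra k Δ →+* Module.End k (∀ x : Δ, Fin (d x) → k) where
  toFun f := LinearMap.pi fun x => ∑ y, (combMatrix M x y (f x y)).mulVecLin ∘ₗ LinearMap.proj y
  map_one' := by
    refine LinearMap.ext fun v => funext fun x => ?_
    simp only [LinearMap.pi_apply, LinearMap.sum_apply, LinearMap.comp_apply, LinearMap.proj_apply,
      Matrix.mulVecLin_apply]
    rw [Finset.sum_eq_single x]
    · rw [PathAlgebra.one_apply_self]
      simp [combMatrix, pathMatrix]
    · intro y _ hy
      rw [PathAlgebra.one_apply_ne hy]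
      simp
    · simp
  map_mul' f g := by
    refine LinearMap.ext fun v => funext fun x => ?_
    simp only [LinearMap.pi_apply, LinearMap.sum_apply, LinearMap.comp_apply, LinearMap.proj_apply,
      Matrix.mulVecLin_apply, Module.End.mul_apply, PathAlgebra.mul_apply, map_sum,
      combMatrix_pathComp, Matrix.mulVec_mulVec]
    exact Finset.sum_comm
  map_zero' := by
    refine LinearMap.ext fun v => funext fun x => ?_
    change (LinearMap.pi fun x => ∑ y, (combMatrix M x y 0).mulVecLin ∘ₗ LinearMap.proj y) v x = 0
    simp
  map_add' f g := by
    refine LinearMap.ext fun v => funext fun x => ?_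
    simp [PathAlgebra.add_apply, Finset.sum_add_distrib]

lemma pathAction_eq_zero {B : BoundQuiver k Δ} {M : ArrowSpace k d d} (hM : B.IsRep M)
    (f : PathAlgebra k Δ) (hf : f ∈ (TwoSidedIdeal.span B.rels).asIdeal) :
    pathAction M f = 0 := by
  have hle : TwoSidedIdeal.span B.rels ≤ TwoSidedIdeal.ker (pathAction M) := by
    rw [TwoSidedIdeal.span_le]
    intro ρ hρ
    rw [SetLike.mem_coe, TwoSidedIdeal.mem_ker]
    refine LinearMap.ext fun v => funext fun x => ?_
    simp [pathAction, hM ρ hρ]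
  rw [TwoSidedIdeal.mem_asIdeal] at hf
  exact (TwoSidedIdeal.mem_ker _).1 (hle hf)

/-- The action of `Λ` on `⨁_x k^{d(x)}` given by a representation of the bound quiver. -/
def BoundQuiver.action (B : BoundQuiver k Δ) (M : ArrowSpace k d d) (hM : B.IsRep M) :
    B.Alg →+* Module.End k (∀ x : Δ, Fin (d x) → k) :=
  Ideal.Quotient.lift _ (pathAction M) (pathAction_eq_zero hM)

/-- The underlying space `⨁_x k^{d(x)}` of the `Λ`-module of a representation. -/
def BoundQuiver.ModuleOf (B : BoundQuiver k Δ) (M : ArrowSpace k d d) (_ : B.IsRep M) :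
    Type max u v :=
  ∀ x : Δ, Fin (d x) → k

instance (B : BoundQuiver k Δ) (M : ArrowSpace k d d) (hM : B.IsRep M) :
    AddCommGroup (B.ModuleOf M hM) :=
  inferInstanceAs (AddCommGroup (∀ x : Δ, Fin (d x) → k))

instance (B : BoundQuiver k Δ) (M : ArrowSpace k d d) (hM : B.IsRep M) :
    Module B.Alg (B.ModuleOf M hM) :=
  Module.compHom (∀ x : Δ, Fin (d x) → k) (B.action M hM)

end Representations

/-- The direct sum `U ⊕ V`, i.e. the block diagonal matrices with blocks `U_α` and `V_α`. -/
def directSum {Δ : Type v} [Quiver.{w} Δ] {R : Type*} [CommRing R] {d₁ d₂ : Δ → ℕ}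
    (U : ArrowSpace R d₁ d₁) (V : ArrowSpace R d₂ d₂) : ArrowSpace R (d₁ + d₂) (d₁ + d₂) :=
  fun a b α => Matrix.reindex finSumFinEquiv finSumFinEquiv
    (Matrix.fromBlocks (U a b α) 0 0 (V a b α))

/-- `M` is block upper triangular with respect to `d = d₁ + d₂`. -/
def IsUpper {Δ : Type v} [Quiver.{w} Δ] {R : Type*} [CommRing R] {d₁ d₂ : Δ → ℕ}
    (M : ArrowSpace R (d₁ + d₂) (d₁ + d₂)) : Prop :=
  ∀ (a b : Δ) (α : a ⟶ b) (i : Fin (d₂ b)) (j : Fin (d₁ a)),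
    M a b α (Fin.natAdd (d₁ b) i) (Fin.castAdd (d₂ a) j) = 0

lemma isUpper_directSum {Δ : Type v} [Quiver.{w} Δ] {R : Type*} [CommRing R] {d₁ d₂ : Δ → ℕ}
    (U : ArrowSpace R d₁ d₁) (V : ArrowSpace R d₂ d₂) : IsUpper (directSum U V) := by
  intro a b α i j
  simp [directSum]

/-- The coboundary map `𝕍^{d₁,d₂} → 𝔸^{d₁,d₂}`, `h ↦ h ∘ U - V ∘ h`. -/
def coboundary {Δ : Type v} [Quiver.{w} Δ] {k : Type u} [Field k] {d₁ d₂ : Δ → ℕ}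
    (U : ArrowSpace k d₁ d₁) (V : ArrowSpace k d₂ d₂) :
    VertexSpace k d₁ d₂ →ₗ[k] ArrowSpace k d₁ d₂ where
  toFun h a b α := h b * U a b α - V a b α * h a
  map_add' h h' := by
    funext a b α
    simp only [Pi.add_apply, Matrix.add_mul, Matrix.mul_add]
    abel
  map_smul' c h := by
    funext a b α
    simp [smul_sub]

/-- The space `𝔹^{U,V}`. -/
def coboundaries {Δ : Type v} [Quiver.{w} Δ] {k : Type u} [Field k] {d₁ d₂ : Δ → ℕ}
    (U : ArrowSpace k d₁ d₁) (V : ArrowSpace k d₂ d₂) : Submodule k (ArrowSpace k d₁ d₂) :=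
  LinearMap.range (coboundary U V)

/-! ### Closed subschemes of the affine space `𝔸^{d,d}` -/

/-- The coordinates of the affine space `𝔸^{d,d}`: matrix positions for each arrow. -/
abbrev Coord {Δ : Type v} [Quiver.{w} Δ] (d : Δ → ℕ) :=
  Σ (a : Δ) (b : Δ) (_ : a ⟶ b), Fin (d b) × Fin (d a)

section Geometry

variable {k : Type u} {Δ : Type v} [Field k] [Quiver.{w} Δ] {d : Δ → ℕ}

/-- The coordinate vector of a family of matrices. -/
def coords {R : Type*} (M : ArrowSpace R d d) : Coord d → R :=
  fun c => M c.1 c.2.1 c.2.2.1 c.2.2.2.1 c.2.2.2.2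

/-- The coordinate ring `k[𝔸^{d,d}]`. -/
abbrev Poly (k : Type u) [Field k] (d : Δ → ℕ) := MvPolynomial (Coord d) k

/-- Evaluation of polynomial functions at an `R`-point of `𝔸^{d,d}`. -/
def evalAt {R : Type*} [CommRing R] [Algebra k R] (M : ArrowSpace R d d) : Poly k d →ₐ[k] R :=
  MvPolynomial.aeval (coords M)

/-- The universal point of `𝔸^{d,d}`. -/
def genericPoint (k : Type u) [Field k] (d : Δ → ℕ) : ArrowSpace (Poly k d) d d :=
  fun a b α => Matrix.of fun i j => MvPolynomial.X ⟨a, b, α, i, j⟩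

/-- The Zariski topology on `𝔸^{d,d}(k)`. -/
@[reducible] def zariski (k : Type u) [Field k] (d : Δ → ℕ) : TopologicalSpace (ArrowSpace k d d) :=
  TopologicalSpace.induced (fun M => MvPolynomial.pointToPoint (k := k) (coords M)) inferInstance

/-- The ideal of polynomial functions vanishing on a set `Z` of `k`-points; it defines `Z` as a
closed subscheme with its reduced structure, when `Z` is closed. -/
def idealOf (Z : Set (ArrowSpace k d d)) : Ideal (Poly k d) :=
  MvPolynomial.vanishingIdeal k (coords '' Z)

lemma mem_idealOf {Z : Set (ArrowSpace k d d)} {f : Poly k d} :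
    f ∈ idealOf Z ↔ ∀ M ∈ Z, evalAt M f = 0 := by
  simp [idealOf, evalAt]

/-- The ideal of the closed subscheme `mod_Λ^d` of `𝔸^{d,d}`, generated by the entries of the
matrices `M_ρ` for the universal point `M`. -/
def BoundQuiver.modIdeal [Fintype Δ] (B : BoundQuiver k Δ) (d : Δ → ℕ) : Ideal (Poly k d) :=
  Ideal.span {f | ∃ ρ ∈ B.rels, ∃ (x y : Δ) (i : Fin (d x)) (j : Fin (d y)),
    f = combMatrix (genericPoint k d) x y (ρ x y) i j}

/-- The ideal of the closed subscheme `ℰ_Λ^{d₂,d₁}` of `𝔸^{d,d}`, `d = d₁ + d₂`: the intersection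
of `mod_Λ^d` with the block upper triangular families of matrices. -/
def BoundQuiver.upperIdeal [Fintype Δ] (B : BoundQuiver k Δ) (d₁ d₂ : Δ → ℕ) :
    Ideal (Poly k (d₁ + d₂)) :=
  B.modIdeal (d₁ + d₂) ⊔
    Ideal.span {f | ∃ (a b : Δ) (α : a ⟶ b) (i : Fin (d₂ b)) (j : Fin (d₁ a)),
      f = genericPoint k (d₁ + d₂) a b α (Fin.natAdd (d₁ b) i) (Fin.castAdd (d₂ a) j)}

lemma map_evalAt {R S : Type*} [CommRing R] [Algebra k R] [CommRing S] [Algebra k S]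
    (φ : R →ₐ[k] S) (M : ArrowSpace R d d) (f : Poly k d) :
    φ (evalAt M f) = evalAt (fun a b α => (M a b α).map φ) f := by
  rw [evalAt, ← AlgHom.comp_apply, MvPolynomial.comp_aeval]
  rfl

lemma map_pathMatrix {R S : Type*} [CommRing R] [CommRing S] [Algebra k R] [Algebra k S]
    (φ : R →ₐ[k] S) (M : ArrowSpace R d d) {x y : Δ} (p : Quiver.Path y x) :
    (pathMatrix M p).map φ = pathMatrix (fun a b α => (M a b α).map φ) p := by
  induction p with
  | nil => simp [pathMatrix]
  | cons p α ih => simp [pathMatrix, ← ih, Matrix.map_mul]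

lemma map_combMatrix {R S : Type*} [CommRing R] [CommRing S] [Algebra k R] [Algebra k S]
    (φ : R →ₐ[k] S) (M : ArrowSpace R d d) {x y : Δ} (f : Quiver.Path y x →₀ k) :
    (combMatrix M x y f).map φ = combMatrix (fun a b α => (M a b α).map φ) x y f := by
  induction f using Finsupp.induction_linear with
  | zero => simp
  | add f₁ f₂ h₁ h₂ => simp [Matrix.map_add, h₁, h₂]
  | single p c =>
    simp only [combMatrix, Finsupp.linearCombination_single, ← map_pathMatrix φ M p]
    ext i j
    simp

lemma map_genericPoint {R : Type*} [CommRing R] [Algebra k R] (M : ArrowSpace R d d) :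
    (fun a b α => (genericPoint k d a b α).map (evalAt M)) = M := by
  funext a b α
  ext i j
  simp [genericPoint, evalAt, coords]

/-- An `R`-point of `𝔸^{d,d}` lies on `mod_Λ^d` iff it is an `R`-representation. -/
lemma BoundQuiver.modIdeal_le_ker_iff [Fintype Δ] (B : BoundQuiver k Δ) {R : Type*} [CommRing R]
    [Algebra k R] (M : ArrowSpace R d d) :
    B.modIdeal d ≤ RingHom.ker (evalAt (k := k) M) ↔ B.IsRep M := by
  have key : ∀ (ρ : PathAlgebra k Δ) (x y : Δ) (i : Fin (d x)) (j : Fin (d y)),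
      evalAt (k := k) M (combMatrix (genericPoint k d) x y (ρ x y) i j) =
        combMatrix M x y (ρ x y) i j := by
    intro ρ x y i j
    have h := map_combMatrix (evalAt (k := k) M) (genericPoint k d) (ρ x y)
    rw [map_genericPoint] at h
    rw [← h, Matrix.map_apply]
  rw [BoundQuiver.modIdeal, Ideal.span_le]
  constructor
  · intro h ρ hρ x y
    ext i j
    rw [← key]
    exact h ⟨ρ, hρ, x, y, i, j, rfl⟩
  · rintro h f ⟨ρ, hρ, x, y, i, j, rfl⟩
    change evalAt (k := k) M _ = 0
    rw [key, h ρ hρ x y]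
    rfl

/-- An `R`-point of `𝔸^{d,d}` lies on `ℰ_Λ^{d₂,d₁}` iff it is an `R`-representation which is block
upper triangular. -/
lemma BoundQuiver.upperIdeal_le_ker_iff [Fintype Δ] (B : BoundQuiver k Δ) {R : Type*} [CommRing R]
    [Algebra k R] {d₁ d₂ : Δ → ℕ} (M : ArrowSpace R (d₁ + d₂) (d₁ + d₂)) :
    B.upperIdeal d₁ d₂ ≤ RingHom.ker (evalAt (k := k) M) ↔ B.IsRep M ∧ IsUpper M := by
  rw [BoundQuiver.upperIdeal, sup_le_iff, B.modIdeal_le_ker_iff, Ideal.span_le]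
  refine and_congr_right fun _ => ⟨?_, ?_⟩
  · intro h a b α i j
    have := h ⟨a, b, α, i, j, rfl⟩
    simpa [genericPoint, evalAt, coords] using this
  · rintro h f ⟨a, b, α, i, j, rfl⟩
    simpa [genericPoint, evalAt, coords] using h a b α i j

/-! ### Points, tangent spaces, smoothness -/

/-- The `k`-point of `Spec (k[𝔸^{d,d}] / J)` given by a common zero `N` of `J`. -/
def evalQuot {J : Ideal (Poly k d)} (N : ArrowSpace k d d) (hN : ∀ f ∈ J, evalAt N f = 0) :
    Poly k d ⧸ J →ₐ[k] k :=
  Ideal.Quotient.liftₐ J (evalAt N) hN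

/-- The maximal ideal of the point `N`. -/
abbrev pointIdeal {J : Ideal (Poly k d)} (N : ArrowSpace k d d)
    (hN : ∀ f ∈ J, evalAt N f = 0) : Ideal (Poly k d ⧸ J) :=
  RingHom.ker (evalQuot N hN)

instance {J : Ideal (Poly k d)} (N : ArrowSpace k d d) (hN : ∀ f ∈ J, evalAt N f = 0) :
    (pointIdeal N hN).IsPrime :=
  RingHom.ker_isPrime (evalQuot N hN)

/-- The point `N + ε W` of `𝔸^{d,d}` over the dual numbers. -/
def dualPoint (N W : ArrowSpace k d d) : ArrowSpace (DualNumber k) d d :=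
  fun a b α => Matrix.of fun i j =>
    TrivSqZeroExt.inl (N a b α i j) + TrivSqZeroExt.inr (W a b α i j)

lemma fst_evalAt_dualPoint (N W : ArrowSpace k d d) (f : Poly k d) :
    (evalAt (dualPoint N W) f).fst = evalAt N f := by
  change TrivSqZeroExt.fstHom k k k _ = _
  rw [map_evalAt]
  congr 2
  funext a b α
  ext i j
  simp [dualPoint]

/-- The `k`-linear map sending `W` to the coefficient of `ε` in `f (N + ε W)`. -/
def dualCoeff (N : ArrowSpace k d d) (f : Poly k d) : ArrowSpace k d d →ₗ[k] k where
  toFun W := (evalAt (dualPoint N W) f).snd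
  map_add' W W' := by
    induction f using MvPolynomial.induction_on with
    | C a => simp [evalAt, TrivSqZeroExt.algebraMap_eq_inl]
    | add p q hp hq =>
      simp only [map_add, TrivSqZeroExt.snd_add, hp, hq]
      ring
    | mul_X p c hp =>
      simp only [map_mul, TrivSqZeroExt.snd_mul, hp, fst_evalAt_dualPoint]
      simp [evalAt, coords, dualPoint]
      ring
  map_smul' c W := by
    induction f using MvPolynomial.induction_on with
    | C a => simp [evalAt, TrivSqZeroExt.algebraMap_eq_inl]
    | add p q hp hq =>
      simp only [map_add, TrivSqZeroExt.snd_add, hp, hq]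
      simp [mul_add]
    | mul_X p c hp =>
      simp only [map_mul, TrivSqZeroExt.snd_mul, hp, fst_evalAt_dualPoint]
      simp [evalAt, coords, dualPoint]
      ring

/-- The tangent space at `N` of the closed subscheme of `𝔸^{d,d}` with ideal `J`; see
`mem_tangentSpace_iff`. -/
def tangentSpace (J : Ideal (Poly k d)) (N : ArrowSpace k d d) :
    Submodule k (ArrowSpace k d d) :=
  ⨅ f ∈ J, LinearMap.ker (dualCoeff N f)

/-- If `N` is a point of the closed subscheme with ideal `J`, then `W` is a tangent vector at `N`
iff `N + ε W` is a point of the subscheme over the dual numbers. -/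
lemma mem_tangentSpace_iff {J : Ideal (Poly k d)} {N : ArrowSpace k d d}
    (hN : ∀ f ∈ J, evalAt N f = 0) (W : ArrowSpace k d d) :
    W ∈ tangentSpace J N ↔ ∀ f ∈ J, evalAt (dualPoint N W) f = 0 := by
  simp only [tangentSpace, Submodule.mem_iInf, LinearMap.mem_ker]
  refine forall₂_congr fun f hf => ?_
  change (evalAt (dualPoint N W) f).snd = 0 ↔ _
  rw [TrivSqZeroExt.ext_iff, fst_evalAt_dualPoint, hN f hf]
  simp

end Geometry

/-- The morphism `Spec B → Spec A` given by `φ : A → B` is smooth at the point `p` of `Spec B`: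
for some `f ∉ p` the ring homomorphism `A → B_f` is smooth. -/
def SmoothAt {A B : Type*} [CommRing A] [CommRing B] (φ : A →+* B) (p : Ideal B) : Prop :=
  ∃ f : B, f ∉ p ∧ ((algebraMap B (Localization.Away f)).comp φ).Smooth

/-! ### The group scheme `GL_d` and its action -/

section Group

variable {k : Type u} {Δ : Type v} [Field k] [Quiver.{w} Δ] {d : Δ → ℕ}

/-- The `R`-points of the group scheme `GL_d = ∏_x GL_{d(x)}`. -/
abbrev GLPoints {Δ : Type v} (R : Type*) [CommRing R] (d : Δ → ℕ) :=
  ∀ x : Δ, Matrix.GeneralLinearGroup (Fin (d x)) R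

/-- The action `(g * M)_α = g_{tα} M_α g_{sα}⁻¹`. -/
def act {R : Type*} [CommRing R] (g : GLPoints R d) (M : ArrowSpace R d d) : ArrowSpace R d d :=
  fun a b α => (g b).val * M a b α * (g a)⁻¹.val

lemma map_act {R S : Type*} [CommRing R] [CommRing S] [Algebra k R] [Algebra k S]
    (φ : R →ₐ[k] S) (g : GLPoints R d) (M : ArrowSpace R d d) :
    (fun a b α => (act g M a b α).map φ) =
      act (fun x => (g x).map φ.toRingHom) (fun a b α => (M a b α).map φ) := by
  funext a b α
  simp only [act, Matrix.map_mul, ← map_inv]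
  rfl

/-- A set of `k`-points which is stable under `GL_d(k)`. -/
def IsInvariant (Z : Set (ArrowSpace k d d)) : Prop :=
  ∀ (g : GLPoints k d), ∀ M ∈ Z, act g M ∈ Z

end Group

section GroupScheme

variable {k : Type u} {Δ : Type v} [Field k] {d : Δ → ℕ}

/-- The polynomial ring in the entries of square matrices of sizes `d(x)`, for all vertices `x`. -/
abbrev GLPoly {Δ : Type v} (k : Type u) [Field k] (d : Δ → ℕ) :=
  MvPolynomial (Σ x : Δ, Fin (d x) × Fin (d x)) k

/-- The universal square matrix of size `d(x)`. -/
def genericMatrix {Δ : Type v} (k : Type u) [Field k] (d : Δ → ℕ) (x : Δ) :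
    Matrix (Fin (d x)) (Fin (d x)) (GLPoly k d) :=
  Matrix.of fun i j => MvPolynomial.X ⟨x, i, j⟩

lemma aeval_det_genericMatrix (g : GLPoints k d) (x : Δ) :
    MvPolynomial.aeval (R := k) (fun c : Σ x : Δ, Fin (d x) × Fin (d x) =>
      (g c.1).val c.2.1 c.2.2) (genericMatrix k d x).det = (g x).val.det := by
  rw [AlgHom.map_det]
  congr 1
  ext i j
  simp [genericMatrix]

variable [Fintype Δ]

/-- The coordinate ring `k[GL_d]`. -/
abbrev GLRing {Δ : Type v} [Fintype Δ] (k : Type u) [Field k] (d : Δ → ℕ) :=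
  Localization.Away (∏ x, (genericMatrix k d x).det)

lemma isUnit_det_genericMatrix {Δ : Type v} [Fintype Δ] (k : Type u) [Field k] (d : Δ → ℕ)
    (x : Δ) :
    IsUnit ((genericMatrix k d x).map (algebraMap (GLPoly k d) (GLRing k d))).det := by
  have h := IsLocalization.Away.algebraMap_isUnit (S := GLRing k d)
    (∏ x, (genericMatrix k d x).det)
  rw [map_prod] at h
  have h' := (IsUnit.prod_univ_iff.1 h) x
  rw [RingHom.map_det] at h'
  exact h'

/-- The universal point of `GL_d`. -/
def genericGL {Δ : Type v} [Fintype Δ] (k : Type u) [Field k] (d : Δ → ℕ) :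
    GLPoints (GLRing k d) d :=
  fun x => Matrix.GeneralLinearGroup.mk'' _ (isUnit_det_genericMatrix k d x)

/-- Evaluation of functions on `GL_d` at a `k`-point. -/
def evalGL (g : GLPoints k d) : GLRing k d →ₐ[k] k :=
  IsLocalization.liftAlgHom (M := Submonoid.powers (∏ x, (genericMatrix k d x).det))
    (f := MvPolynomial.aeval (R := k) fun c : Σ x : Δ, Fin (d x) × Fin (d x) =>
      (g c.1).val c.2.1 c.2.2)
    (by
      rintro ⟨y, n, rfl⟩
      simp only [map_pow, map_prod, aeval_det_genericMatrix]
      exact (IsUnit.prod_univ_iff.2 fun x => (Matrix.isUnit_iff_isUnit_det _).1 (g x).isUnit).pow n)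

lemma evalGL_algebraMap (g : GLPoints k d) (p : GLPoly k d) :
    evalGL g (algebraMap (GLPoly k d) (GLRing k d) p) =
      MvPolynomial.aeval (R := k) (fun c : Σ x : Δ, Fin (d x) × Fin (d x) =>
        (g c.1).val c.2.1 c.2.2) p := by
  simp [evalGL]

/-- A function on `GL_d` which vanishes at all `k`-points is zero. -/
lemma eq_zero_of_evalGL [Infinite k] (c : GLRing k d) (h : ∀ g : GLPoints k d, evalGL g c = 0) :
    c = 0 := by
  obtain ⟨⟨p, s⟩, hs⟩ := IsLocalization.surj
    (Submonoid.powers (∏ x, (genericMatrix k d x).det)) c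
  have hp : ∀ g : GLPoints k d, evalGL g (algebraMap (GLPoly k d) (GLRing k d) p) = 0 := by
    intro g
    rw [← hs, map_mul, h g, zero_mul]
  have hne : (∏ x, (genericMatrix k d x).det) ≠ 0 := by
    intro h0
    have := congrArg (MvPolynomial.aeval (R := k) fun c : Σ x : Δ, Fin (d x) × Fin (d x) =>
      ((1 : GLPoints k d) c.1).val c.2.1 c.2.2) h0
    simp only [map_prod, aeval_det_genericMatrix, map_zero] at this
    simp at this
  have hmul : p * ∏ x, (genericMatrix k d x).det = 0 := by
    refine MvPolynomial.funext fun v => ?_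
    rw [map_mul, map_zero]
    by_cases hv : IsUnit (MvPolynomial.eval v (∏ x, (genericMatrix k d x).det))
    · rw [map_prod, IsUnit.prod_univ_iff] at hv
      have hdet : ∀ x, IsUnit (Matrix.of fun i j => v ⟨x, i, j⟩ :
          Matrix (Fin (d x)) (Fin (d x)) k).det := by
        intro x
        have := hv x
        rw [RingHom.map_det] at this
        convert! this using 2
        ext i j
        simp [genericMatrix]
      have := hp fun x => Matrix.GeneralLinearGroup.mk'' _ (hdet x)
      rw [evalGL_algebraMap] at this
      have h2 : MvPolynomial.eval v p = 0 := by
        rw [← this, MvPolynomial.aeval_eq_eval]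
        rfl
      rw [h2, zero_mul]
    · rw [isUnit_iff_ne_zero, not_not] at hv
      rw [hv, mul_zero]
  have hp0 : p = 0 := (mul_eq_zero.1 hmul).resolve_right hne
  rw [hp0, map_zero] at hs
  exact ((IsLocalization.map_units (GLRing k d) s).mul_left_eq_zero).1 hs

lemma map_evalGL_genericGL (g : GLPoints k d) (x : Δ) :
    (genericGL k d x).map (evalGL g).toRingHom = g x := by
  ext i j
  change evalGL g (algebraMap (GLPoly k d) (GLRing k d) _) = _
  rw [evalGL_algebraMap]
  simp [genericMatrix]

end GroupScheme

section Action

variable {k : Type u} {Δ : Type v} [Field k] [Quiver.{w} Δ] [Fintype Δ] {d : Δ → ℕ}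

/-- The coordinate ring of the scheme `GL_d × Spec (k[𝔸^{d,d}] / J)`. -/
abbrev ProdRing (J : Ideal (Poly k d)) := GLRing k d ⊗[k] (Poly k d ⧸ J)

/-- The map `(g, M) ↦ g * M` from `GL_d × Spec (k[𝔸^{d,d}] / J)` to `𝔸^{d,d}`, as a homomorphism
of coordinate rings: it evaluates functions at `g * M` for the universal pair `(g, M)`. -/
def actionToAffine (J : Ideal (Poly k d)) : Poly k d →ₐ[k] ProdRing J :=
  evalAt (act
    (fun x => (genericGL k d x).map
      (Algebra.TensorProduct.includeLeft : GLRing k d →ₐ[k] ProdRing J).toRingHom)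
    (fun a b α => (genericPoint k d a b α).map
      ((Algebra.TensorProduct.includeRight : Poly k d ⧸ J →ₐ[k] ProdRing J).comp
        (Ideal.Quotient.mkₐ k J))))

/-- If `Z` is invariant under `GL_d(k)` and `Spec (k[𝔸^{d,d}] / J)` is a subscheme of `Z` with its
reduced structure, then the map `(g, M) ↦ g * M` takes values in `Z`. -/
lemma actionToAffine_eq_zero [Infinite k] {Z : Set (ArrowSpace k d d)} (hZ : IsInvariant Z)
    {J : Ideal (Poly k d)} (hJ : idealOf Z ≤ J) (f : Poly k d) (hf : f ∈ idealOf Z) :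
    actionToAffine J f = 0 := by
  let b := Module.Free.chooseBasis k (Poly k d ⧸ J)
  have key : ∀ g : GLPoints k d,
      Algebra.TensorProduct.map (evalGL g) (AlgHom.id k (Poly k d ⧸ J)) (actionToAffine J f) = 0 := by
    intro g
    let ψ : Poly k d →ₐ[k] k ⊗[k] (Poly k d ⧸ J) :=
      (Algebra.TensorProduct.includeRight : Poly k d ⧸ J →ₐ[k] k ⊗[k] (Poly k d ⧸ J)).comp
        (Ideal.Quotient.mkₐ k J)
    let F : Poly k d :=
      evalAt (act (fun x => (g x).map (algebraMap k (Poly k d))) (genericPoint k d)) f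
    have hF : F ∈ idealOf Z := by
      rw [mem_idealOf]
      intro M hM
      rw [map_evalAt, map_act, map_genericPoint]
      have hg : (fun x => ((g x).map (algebraMap k (Poly k d))).map (evalAt M).toRingHom) = g := by
        funext x
        ext i j
        exact (evalAt M).commutes _
      rw [hg]
      exact mem_idealOf.1 hf _ (hZ g M hM)
    have hψ : ψ F = 0 := by
      change Algebra.TensorProduct.includeRight (Ideal.Quotient.mk J F) = _
      rw [Ideal.Quotient.eq_zero_iff_mem.2 (hJ hF), map_zero]
    rw [← hψ]
    let T : ProdRing J →ₐ[k] k ⊗[k] (Poly k d ⧸ J) :=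
      Algebra.TensorProduct.map (evalGL g) (AlgHom.id k (Poly k d ⧸ J))
    change T (actionToAffine J f) = ψ F
    refine (map_evalAt (R := ProdRing J) (S := k ⊗[k] (Poly k d ⧸ J)) T _ f).trans
      (Eq.trans ?_ (map_evalAt (S := k ⊗[k] (Poly k d ⧸ J)) ψ _ f).symm)
    have h₁ := map_act (R := ProdRing J) (S := k ⊗[k] (Poly k d ⧸ J)) T
      (fun x => (genericGL k d x).map
        (Algebra.TensorProduct.includeLeft : GLRing k d →ₐ[k] ProdRing J).toRingHom)
      (fun a b α => (genericPoint k d a b α).map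
        ((Algebra.TensorProduct.includeRight : Poly k d ⧸ J →ₐ[k] ProdRing J).comp
          (Ideal.Quotient.mkₐ k J)))
    have h₂ := map_act (S := k ⊗[k] (Poly k d ⧸ J)) ψ
      (fun x => (g x).map (algebraMap k (Poly k d))) (genericPoint k d)
    refine congrArg (fun M => evalAt (k := k) M f) (h₁.trans (Eq.trans ?_ h₂.symm))
    congr 1
    · funext x
      ext i j
      change Algebra.TensorProduct.map (evalGL g) (AlgHom.id k (Poly k d ⧸ J))
        ((genericGL k d x).val i j ⊗ₜ 1) = ψ (algebraMap k (Poly k d) ((g x).val i j))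
      rw [Algebra.TensorProduct.map_tmul, AlgHom.commutes]
      have : evalGL g ((genericGL k d x).val i j) = (g x).val i j :=
        congrArg (fun h : Matrix.GeneralLinearGroup _ k => h.val i j) (map_evalGL_genericGL g x)
      rw [this, map_one]
      rfl
    · funext a b α
      ext i j
      change Algebra.TensorProduct.map (evalGL g) (AlgHom.id k (Poly k d ⧸ J))
        (1 ⊗ₜ Ideal.Quotient.mk J _) = 1 ⊗ₜ Ideal.Quotient.mk J _
      rw [Algebra.TensorProduct.map_tmul, map_one]
      rfl
  have coeff : ∀ (g : GLPoints k d) (t : ProdRing J) (i),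
      evalGL g ((Algebra.TensorProduct.basis (GLRing k d) b).repr t i) =
      (Algebra.TensorProduct.basis k b).repr
        (Algebra.TensorProduct.map (evalGL g) (AlgHom.id k (Poly k d ⧸ J)) t) i := by
    intro g t i
    induction t using TensorProduct.induction_on with
    | zero => simp
    | add x y hx hy => simp only [map_add, Finsupp.add_apply, hx, hy]
    | tmul x y => simp [Algebra.TensorProduct.basis_repr_tmul]
  apply (Algebra.TensorProduct.basis (GLRing k d) b).repr.injective
  ext i
  rw [map_zero, Finsupp.zero_apply]
  refine eq_zero_of_evalGL _ fun g => ?_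
  rw [coeff, key]
  simp

/-- The map `GL_d × W → Z`, `(g, M) ↦ g * M`, as a homomorphism of coordinate rings. Here `Z` is an
invariant set of `k`-points with its reduced structure, and `W` is the subscheme of `Z` with
ideal `J`. -/
def actionMap [Infinite k] {Z : Set (ArrowSpace k d d)} (hZ : IsInvariant Z)
    {J : Ideal (Poly k d)} (hJ : idealOf Z ≤ J) : Poly k d ⧸ idealOf Z →ₐ[k] ProdRing J :=
  Ideal.Quotient.liftₐ (idealOf Z) (actionToAffine J) (actionToAffine_eq_zero hZ hJ)

/-- The maximal ideal of the point `(g, N)` of `GL_d × Spec (k[𝔸^{d,d}] / J)`. -/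
abbrev prodPointIdeal {J : Ideal (Poly k d)} (g : GLPoints k d) (N : ArrowSpace k d d)
    (hN : ∀ f ∈ J, evalAt N f = 0) : Ideal (ProdRing J) :=
  RingHom.ker (Algebra.TensorProduct.productMap (evalGL g) (evalQuot N hN))

/-- The ideal of the scheme-theoretic intersection `Z ∩ ℰ_Λ^{d₂,d₁}`, where `Z` has its reduced
structure. -/
def BoundQuiver.interIdeal (B : BoundQuiver k Δ) {d₁ d₂ : Δ → ℕ}
    (Z : Set (ArrowSpace k (d₁ + d₂) (d₁ + d₂))) : Ideal (Poly k (d₁ + d₂)) :=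
  idealOf Z ⊔ B.upperIdeal d₁ d₂

lemma BoundQuiver.idealOf_le_interIdeal (B : BoundQuiver k Δ) {d₁ d₂ : Δ → ℕ}
    (Z : Set (ArrowSpace k (d₁ + d₂) (d₁ + d₂))) : idealOf Z ≤ B.interIdeal Z :=
  le_sup_left

lemma BoundQuiver.interIdeal_eval (B : BoundQuiver k Δ) {d₁ d₂ : Δ → ℕ}
    {Z : Set (ArrowSpace k (d₁ + d₂) (d₁ + d₂))} (hZ : ∀ M ∈ Z, B.IsRep M)
    {N : ArrowSpace k (d₁ + d₂) (d₁ + d₂)} (hN : N ∈ Z) (hu : IsUpper N) :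
    ∀ f ∈ B.interIdeal Z, evalAt N f = 0 := by
  have h : B.interIdeal Z ≤ RingHom.ker (evalAt (k := k) N) :=
    sup_le (fun f hf => mem_idealOf.1 hf N hN)
      ((B.upperIdeal_le_ker_iff N).2 ⟨hZ N hN, hu⟩)
  exact fun f hf => h hf

end Action

end QuiverRep
end

/-! For representations `A`, `D` consider the linear maps `h ↦ hA - Dh` (written ∂, `cobd`) and `C
↦` (the lower left blocks of the relations at `[A 0; C D]`) (written δ, `combDelta`). The kernel of
δ consists of the cocycles, that is, of the extensions of `A` by `D`; since `Ext¹(U, V) = 0`, every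
cocycle at `(U, V)` is a coboundary (`mem_coboundaries_of_ext`).

This exactness is stable under deformation. Over `k` there are linear maps `X`, `Y` with `∂X + Yδ =
1` (`exists_homotopyMap_eq_id`). With `X` and `Y` fixed, the determinant of `∂X + Yδ` is a
polynomial `t` in the point, equal to `1` at `N`. Hence if `I² = 0` and `M` is a representation over
`R` with `t(M)` a unit and lower left block in `I`, that block is `∂h` with `h` in `I`
(`exists_poly_exists_cobd_eq`). Since `[1 0; h 1]` changes the lower left block by `∂h` when `h` has
entries in `I`, acting by `[1 0; -h 1]` makes `M` block upper triangular.

Smoothness follows from infinitesimal lifting (`smoothAt_actionMap`): lift the group element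
arbitrarily, move the given point of `Z` back by it, then correct by `[1 0; -h 1]`. The moved points
stay in the scheme `Z`, because invariance under `GL_d(k)` implies scheme-theoretic invariance
(`evalAt_act_eq_zero`). Reducedness at `N` follows since a smooth algebra over a reduced ring is
reduced and the intersection is a retract of its product with `GL_d`, through `M ↦ (1, M)`. For the
dimension formula, `W ↦ W₂₁` on the tangent space of `Z` at `N` has the tangent space of the
intersection as kernel and the coboundaries as image. -/

noncomputable section

/-! ### Reducedness along smooth maps and retracts -/

/-- A polynomial over a reduced ring which is integral over the coefficients is constant. -/
lemma Polynomial.eq_C_of_isIntegral {R : Type*} [CommRing R] [IsReduced R] {p : Polynomial R}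
    (hp : IsIntegral R p) : p = Polynomial.C (p.coeff 0) := by
  obtain ⟨f, hf, hfp⟩ := hp
  ext n
  rcases Nat.eq_zero_or_pos n with rfl | hn
  · simp
  rw [Polynomial.coeff_C_of_ne_zero hn.ne']
  refine IsReduced.eq_zero _ ?_
  -- It suffices to work modulo each prime: over a domain, a monic `f` with `f ∘ p = 0` forces `p`
  -- to be constant.
  rw [← mem_nilradical, nilradical_eq_sInf, Ideal.mem_sInf]
  intro P hP
  have hP' : P.IsPrime := hP
  let φ := Ideal.Quotient.mk P
  have h0 : (f.map φ).comp (p.map φ) = 0 := by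
    rw [← Polynomial.map_comp]
    have : f.comp p = 0 := hfp
    rw [this, Polynomial.map_zero]
  rcases Polynomial.comp_eq_zero_iff.1 h0 with h | ⟨-, h⟩
  · exact absurd h (hf.map φ).ne_zero
  · have := congrArg (fun q => Polynomial.coeff q n) h
    simp only [Polynomial.coeff_map, Polynomial.coeff_C_of_ne_zero hn.ne'] at this
    exact Ideal.Quotient.eq_zero_iff_mem.1 this

/-- A smooth algebra over a reduced ring is reduced. -/
lemma Algebra.Smooth.isReduced (R S : Type*) [CommRing R] [CommRing S] [Algebra R S]
    [IsReduced R] [Algebra.Smooth R S] : IsReduced S := by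
  refine ⟨fun n hn => ?_⟩
  -- This element is `nX` in `S[X]`. It is nilpotent, hence integral over `S`. Integral closure
  -- commutes with smooth base change and `R` is integrally closed in `R[X]`, so `nX` must be
  -- constant, whence `n = 0`.
  let z : S ⊗[R] Polynomial R := n ⊗ₜ Polynomial.X
  have hz : IsIntegral S z := by
    obtain ⟨m, hm⟩ := hn
    refine ⟨Polynomial.X ^ m, Polynomial.monic_X_pow m, ?_⟩
    simp [z, Algebra.TensorProduct.tmul_pow, hm]
  obtain ⟨y, hy⟩ := (TensorProduct.toIntegralClosure_bijective_of_smooth (R := R) (S := S)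
    (B := Polynomial R)).2 ⟨z, hz⟩
  have hconst : ∀ y : S ⊗[R] integralClosure R (Polynomial R), ∃ s : S,
      (TensorProduct.toIntegralClosure R S (Polynomial R) y : S ⊗[R] Polynomial R) =
        s ⊗ₜ 1 := by
    intro y
    induction y using TensorProduct.induction_on with
    | zero => exact ⟨0, by simp⟩
    | add a b ha hb =>
      obtain ⟨s, hs⟩ := ha
      obtain ⟨t, ht⟩ := hb
      exact ⟨s + t, by simp [hs, ht, TensorProduct.add_tmul]⟩
    | tmul a b =>
      refine ⟨b.1.coeff 0 • a, ?_⟩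
      have hb : b.1 = b.1.coeff 0 • (1 : Polynomial R) := by
        conv_lhs => rw [Polynomial.eq_C_of_isIntegral b.2]
        rw [Polynomial.smul_eq_C_mul, mul_one]
      rw [TensorProduct.smul_tmul, ← hb]
      rfl
  obtain ⟨s, hs⟩ := hconst y
  rw [hy] at hs
  have h2 := congrArg (fun q => ((polyEquivTensor R S).symm q).coeff 1) hs
  simpa [z, polyEquivTensor_symm_apply_tmul_eq_smul, Polynomial.coeff_one] using h2

/-- If `C` is a retract of `D` and some localization of `D` at an element not vanishing at the
image of `q` is reduced, then `C` is reduced at `q`. -/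
lemma isReduced_localization_of_retract {C D : Type*} [CommRing C] [CommRing D] (ι : C →+* D)
    (ev : D →+* C) (hev : ∀ y, ev (ι y) = y) (q : Ideal C) [q.IsPrime] (f : D) (hf : ev f ∉ q)
    [IsReduced (Localization.Away f)] : IsReduced (Localization.AtPrime q) := by
  refine ⟨fun z ⟨n, hn⟩ => ?_⟩
  obtain ⟨⟨x, s⟩, hxs⟩ := IsLocalization.surj q.primeCompl z
  have hx : algebraMap _ (Localization.AtPrime q) (x ^ n) = 0 := by
    rw [map_pow, ← hxs, mul_pow, hn, zero_mul]
  obtain ⟨u, hu⟩ := (IsLocalization.map_eq_zero_iff q.primeCompl _ _).1 hx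
  -- The exponent `n + 1` leaves a factor `u` to pair with `x ^ n`, even for `n = 0`.
  have hy : IsNilpotent ((u : C) * x) := ⟨n + 1, by
    rw [pow_succ, mul_pow]
    calc (u : C) ^ n * x ^ n * (u * x) = u ^ n * x * (u * x ^ n) := by ring
      _ = 0 := by rw [hu, mul_zero]⟩
  have hz : algebraMap D (Localization.Away f) (ι (u * x)) = 0 :=
    ((hy.map ι).map (algebraMap D (Localization.Away f))).eq_zero
  obtain ⟨⟨_, m, rfl⟩, hm⟩ := (IsLocalization.map_eq_zero_iff (Submonoid.powers f) _ _).1 hz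
  -- Applying the retraction to `f ^ m * ι (u * x) = 0` brings the annihilation back to `C`, with a
  -- multiplier outside `q`.
  have hw : ev f ^ m ∉ q := fun h => hf (Ideal.IsPrime.mem_of_pow_mem inferInstance m h)
  have hwy : ev f ^ m * (u * x) = 0 := by
    have h := congrArg ev hm
    rwa [map_mul, map_zero, hev, map_pow] at h
  have hx0 : algebraMap _ (Localization.AtPrime q) x = 0 :=
    (IsLocalization.map_eq_zero_iff q.primeCompl _ _).2
      ⟨⟨ev f ^ m, hw⟩ * u, by rw [← hwy, Submonoid.coe_mul, mul_assoc]⟩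
  rw [hx0] at hxs
  exact ((IsLocalization.map_units _ s).mul_left_eq_zero).1 hxs

namespace QuiverRep

/-! ### Infinitesimal lifting and square-zero ideals -/

/-- Smoothness at a point via the infinitesimal lifting criterion. -/
lemma smoothAt_of_lifting {A B : Type u} [CommRing A] [CommRing B] (φ : A →+* B)
    (hφ : φ.FinitePresentation) (p : Ideal B) [p.IsPrime]
    (H : ∀ (R : Type u) [CommRing R] (I : Ideal R), I ^ 2 = ⊥ → ∀ (a : A →+* R)
      (b : B →+* R ⧸ I), (∀ x ∉ p, IsUnit (b x)) → (Ideal.Quotient.mk I).comp a = b.comp φ →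
      ∃ c : B →+* R, c.comp φ = a ∧ (Ideal.Quotient.mk I).comp c = b) : SmoothAt φ p := by
  let _ := φ.toAlgebra
  have : Algebra.FinitePresentation A B := hφ
  have : Algebra.IsSmoothAt A p := by
    refine Algebra.FormallySmooth.of_comp_surjective fun R _ _ I hI b => ?_
    let b' : B →+* R ⧸ I := b.toRingHom.comp (algebraMap B (Localization.AtPrime p))
    have hb' : ∀ x ∉ p, IsUnit (b' x) := fun x hx =>
      (IsLocalization.map_units (Localization.AtPrime p) (⟨x, hx⟩ : p.primeCompl)).map b
    obtain ⟨c, hc₁, hc₂⟩ := H R I hI (algebraMap A R) b' hb' (by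
      ext x
      have := (b.commutes x).symm
      rw [IsScalarTower.algebraMap_apply A B (Localization.AtPrime p)] at this
      exact this)
    -- Units lift along a nilpotent ideal, so a lift defined on `B` extends to the localization at
    -- `p`.
    have hnil : ∀ x : R, IsUnit (Ideal.Quotient.mk I x) → IsUnit x := fun x hx =>
      (IsNilpotent.isUnit_quotient_mk_iff ⟨2, hI⟩).1 hx
    have hc : ∀ y : p.primeCompl, IsUnit (c y) := fun y => hnil _ (by
      have := hb' y y.2
      rwa [← hc₂] at this)
    refine ⟨⟨IsLocalization.lift hc, fun x => ?_⟩, ?_⟩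
    · rw [IsScalarTower.algebraMap_apply A B (Localization.AtPrime p)]
      change IsLocalization.lift hc _ = _
      rw [IsLocalization.lift_eq, ← hc₁]
      rfl
    · apply AlgHom.coe_ringHom_injective
      refine IsLocalization.ringHom_ext p.primeCompl (RingHom.ext fun x => ?_)
      change Ideal.Quotient.mk I (IsLocalization.lift hc _) = _
      rw [IsLocalization.lift_eq]
      exact congrArg (fun f : B →+* R ⧸ I => f x) hc₂
  obtain ⟨f, hf, hs⟩ := Algebra.IsSmoothAt.exists_notMem_smooth A p
  refine ⟨f, hf, ?_⟩
  have : (algebraMap B (Localization.Away f)).comp φ = algebraMap A (Localization.Away f) := rfl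
  rw [this]
  exact RingHom.smooth_algebraMap.2 hs

lemma SmoothAt.exists_isReduced {A B : Type*} [CommRing A] [CommRing B] [IsReduced A]
    {φ : A →+* B} {p : Ideal B} (h : SmoothAt φ p) :
    ∃ f : B, f ∉ p ∧ IsReduced (Localization.Away f) := by
  obtain ⟨f, hf, hs⟩ := h
  let _ := ((algebraMap B (Localization.Away f)).comp φ).toAlgebra
  have : Algebra.Smooth A (Localization.Away f) := hs
  exact ⟨f, hf, Algebra.Smooth.isReduced A _⟩

lemma submatrix_mul_fin {R ι κ ι' κ' : Type*} [CommRing R] {m n : ℕ} (X : Matrix ι (Fin (m + n)) R)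
    (Y : Matrix (Fin (m + n)) κ R) (f : ι' → ι) (g : κ' → κ) :
    (X * Y).submatrix f g =
      X.submatrix f (Fin.castAdd n) * Y.submatrix (Fin.castAdd n) g +
        X.submatrix f (Fin.natAdd m) * Y.submatrix (Fin.natAdd m) g := by
  ext i j
  simp [Matrix.mul_apply, Fin.sum_univ_add]

/-- Since `I² = 0`, a factor with entries in `I` sees the other factor only modulo `I`. -/
lemma mul_eq_mul_of_sq_zero {R ι κ μ : Type*} [CommRing R] [Fintype κ] {I : Ideal R}
    (hI : I ^ 2 = ⊥) {X : Matrix ι κ R} {Y Y' : Matrix κ μ R} (hX : ∀ i j, X i j ∈ I)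
    (hY : Y.map (Ideal.Quotient.mk I) = Y'.map (Ideal.Quotient.mk I)) : X * Y = X * Y' := by
  rw [← sub_eq_zero, ← Matrix.mul_sub]
  ext i j
  rw [Matrix.mul_apply, Matrix.zero_apply]
  refine Finset.sum_eq_zero fun l _ => ?_
  have h : (Y - Y') l j ∈ I := by
    rw [Matrix.sub_apply, ← Ideal.Quotient.eq]
    exact congrFun (congrFun hY l) j
  have := Ideal.mul_mem_mul (hX i l) h
  rwa [← sq, hI] at this

lemma mul_eq_zero_of_sq_zero {R ι κ μ : Type*} [CommRing R] [Fintype κ] {I : Ideal R}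
    (hI : I ^ 2 = ⊥) {X : Matrix ι κ R} {Y : Matrix κ μ R} (hX : ∀ i j, X i j ∈ I)
    (hY : Y.map (Ideal.Quotient.mk I) = 0) : X * Y = 0 := by
  rw [mul_eq_mul_of_sq_zero hI hX (Y' := 0) (by rw [hY]; ext; simp), Matrix.mul_zero]

lemma mul_eq_zero_of_sq_zero' {R ι κ μ : Type*} [CommRing R] [Fintype κ] {I : Ideal R}
    (hI : I ^ 2 = ⊥) {X : Matrix ι κ R} {Y : Matrix κ μ R} (hX : X.map (Ideal.Quotient.mk I) = 0)
    (hY : ∀ i j, Y i j ∈ I) : X * Y = 0 := by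
  rw [← Matrix.transpose_inj, Matrix.transpose_mul, Matrix.transpose_zero]
  exact mul_eq_zero_of_sq_zero hI (fun i j => hY j i)
    (by rw [Matrix.transpose_map, hX, Matrix.transpose_zero])

/-! ### Block matrices along paths and the linearized relations -/

section Blocks

variable {Δ : Type v} [Quiver.{w} Δ] {R S : Type*} [CommRing R] [CommRing S] {d₁ d₂ : Δ → ℕ}

/-- The upper left blocks. -/
def block₁₁ (M : ArrowSpace R (d₁ + d₂) (d₁ + d₂)) : ArrowSpace R d₁ d₁ :=
  fun a b α => (M a b α).submatrix (Fin.castAdd (d₂ b)) (Fin.castAdd (d₂ a))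

/-- The upper right blocks. -/
def block₁₂ (M : ArrowSpace R (d₁ + d₂) (d₁ + d₂)) : ArrowSpace R d₂ d₁ :=
  fun a b α => (M a b α).submatrix (Fin.castAdd (d₂ b)) (Fin.natAdd (d₁ a))

/-- The lower left blocks. -/
def block₂₁ (M : ArrowSpace R (d₁ + d₂) (d₁ + d₂)) : ArrowSpace R d₁ d₂ :=
  fun a b α => (M a b α).submatrix (Fin.natAdd (d₁ b)) (Fin.castAdd (d₂ a))

/-- The lower right blocks. -/
def block₂₂ (M : ArrowSpace R (d₁ + d₂) (d₁ + d₂)) : ArrowSpace R d₂ d₂ :=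
  fun a b α => (M a b α).submatrix (Fin.natAdd (d₁ b)) (Fin.natAdd (d₁ a))

lemma isUpper_iff_block₂₁ (M : ArrowSpace R (d₁ + d₂) (d₁ + d₂)) :
    IsUpper M ↔ block₂₁ M = 0 := by
  constructor
  · intro h
    funext a b α
    ext i j
    exact h a b α i j
  · intro h a b α i j
    exact congrFun (congrFun (congrFun (congrFun (congrFun h a) b) α) i) j

/-- The block lower triangular matrices with given blocks. -/
def lowerTri (A : ArrowSpace R d₁ d₁) (C : ArrowSpace R d₁ d₂) (D : ArrowSpace R d₂ d₂) :
    ArrowSpace R (d₁ + d₂) (d₁ + d₂) :=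
  fun a b α => Matrix.reindex finSumFinEquiv finSumFinEquiv
    (Matrix.fromBlocks (A a b α) 0 (C a b α) (D a b α))

variable (A : ArrowSpace R d₁ d₁) (C : ArrowSpace R d₁ d₂) (D : ArrowSpace R d₂ d₂)

lemma block₁₁_lowerTri : block₁₁ (lowerTri A C D) = A := by
  funext a b α; ext i j; simp [block₁₁, lowerTri]

lemma block₂₂_lowerTri : block₂₂ (lowerTri A C D) = D := by
  funext a b α; ext i j; simp [block₂₂, lowerTri]

lemma directSum_eq_lowerTri : directSum A D = lowerTri A 0 D := rfl

/-- The map `h ↦ h A - D h` over a commutative ring. -/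
def cobd : VertexSpace R d₁ d₂ →ₗ[R] ArrowSpace R d₁ d₂ where
  toFun h a b α := h b * A a b α - D a b α * h a
  map_add' h h' := by
    funext a b α
    simp only [Pi.add_apply, Matrix.add_mul, Matrix.mul_add]
    abel
  map_smul' c h := by
    funext a b α
    simp [smul_sub]

lemma cobd_apply (h : VertexSpace R d₁ d₂) (a b : Δ) (α : a ⟶ b) :
    cobd A D h a b α = h b * A a b α - D a b α * h a := rfl

/-- The sum of the products `D ⋯ D C A ⋯ A` along a path. -/
def pathDelta {y : Δ} : ∀ {x : Δ}, Quiver.Path y x → Matrix (Fin (d₂ x)) (Fin (d₁ y)) R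
  | _, .nil => 0
  | _, .cons p α => C _ _ α * pathMatrix A p + D _ _ α * pathDelta p

lemma pathDelta_add (C' : ArrowSpace R d₁ d₂) {x y : Δ} (p : Quiver.Path y x) :
    pathDelta A (C + C') D p = pathDelta A C D p + pathDelta A C' D p := by
  induction p with
  | nil => simp [pathDelta]
  | cons p α ih =>
    simp only [pathDelta, ih, Pi.add_apply, Matrix.add_mul, Matrix.mul_add]
    abel

lemma pathDelta_smul (c : R) {x y : Δ} (p : Quiver.Path y x) :
    pathDelta A (c • C) D p = c • pathDelta A C D p := by
  induction p with
  | nil => simp [pathDelta]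
  | cons p α ih => simp [pathDelta, ih]

/-- Telescoping: with `hA - Dh` inserted at each arrow in turn, neighbouring terms cancel and only
the two ends of the path remain. -/
lemma pathDelta_cobd (h : VertexSpace R d₁ d₂) {x y : Δ} (p : Quiver.Path y x) :
    pathDelta A (cobd A D h) D p = h x * pathMatrix A p - pathMatrix D p * h y := by
  induction p with
  | nil => simp [pathDelta, pathMatrix]
  | cons p α ih =>
    simp only [pathDelta, ih, pathMatrix, cobd_apply, Matrix.sub_mul, Matrix.mul_sub,
      Matrix.mul_assoc]
    abel

lemma pathMatrix_blocks_of_isUpper {M : ArrowSpace R (d₁ + d₂) (d₁ + d₂)} (hM : IsUpper M)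
    {x y : Δ} (p : Quiver.Path y x) :
    (pathMatrix M p).submatrix (Fin.natAdd (d₁ x)) (Fin.castAdd (d₂ y)) = 0 ∧
    (pathMatrix M p).submatrix (Fin.castAdd (d₂ x)) (Fin.castAdd (d₂ y)) =
      pathMatrix (block₁₁ M) p ∧
    (pathMatrix M p).submatrix (Fin.natAdd (d₁ x)) (Fin.natAdd (d₁ y)) =
      pathMatrix (block₂₂ M) p := by
  induction p with
  | nil =>
    simp only [pathMatrix]
    refine ⟨?_, ?_, ?_⟩ <;> ext i j
    · simp [Matrix.one_apply, Fin.ext_iff]; omega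
    · simp [Matrix.one_apply, Fin.ext_iff]
    · simp [Matrix.one_apply, Fin.ext_iff]
  | @cons b c p α ih =>
    obtain ⟨h₁, h₂, h₃⟩ := ih
    have hα : (M b c α).submatrix (Fin.natAdd (d₁ c)) (Fin.castAdd (d₂ b)) = 0 := by
      ext i j; exact hM _ _ α i j
    simp only [pathMatrix]
    refine ⟨?_, ?_, ?_⟩
    · refine (submatrix_mul_fin (m := d₁ b) (n := d₂ b) _ _ _ _).trans ?_
      rw [h₁, hα]; simp
    · refine (submatrix_mul_fin (m := d₁ b) (n := d₂ b) _ _ _ _).trans ?_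
      rw [h₁, h₂, Matrix.mul_zero, add_zero]; rfl
    · refine (submatrix_mul_fin (m := d₁ b) (n := d₂ b) _ _ _ _).trans ?_
      rw [h₃, hα, Matrix.zero_mul, zero_add]; rfl

lemma pathMatrix_lowerTri {x y : Δ} (p : Quiver.Path y x) :
    pathMatrix (lowerTri A C D) p = Matrix.reindex finSumFinEquiv finSumFinEquiv
      (Matrix.fromBlocks (pathMatrix A p) 0 (pathDelta A C D p) (pathMatrix D p)) := by
  induction p with
  | nil => simp [pathMatrix, pathDelta]
  | cons p α ih =>
    simp only [pathMatrix, pathDelta, ih, lowerTri, Matrix.reindex_apply]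
    refine (Matrix.submatrix_mul_equiv _ _ _ finSumFinEquiv.symm _).trans ?_
    rw [Matrix.fromBlocks_multiply]
    simp

variable {k : Type u} [Field k] [Algebra k R] [Algebra k S]

lemma map_pathDelta (φ : R →ₐ[k] S) {x y : Δ} (p : Quiver.Path y x) :
    (pathDelta A C D p).map φ = pathDelta (fun a b α => (A a b α).map φ)
      (fun a b α => (C a b α).map φ) (fun a b α => (D a b α).map φ) p := by
  induction p with
  | nil => simp [pathDelta]
  | cons p α ih =>
    simp [pathDelta, ← ih, Matrix.map_add, Matrix.map_mul, ← map_pathMatrix φ A p]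

/-- The upper right block is arbitrary here. It spoils the upper left block of a product only by
elements of `I`, and these are then multiplied by the lower left block of an arrow, also in `I`. The
field `k'` serves to make the reduction modulo `I` an algebra homomorphism. -/
lemma block₂₁_pathMatrix (k' : Type*) [Field k'] [Algebra k' R] {I : Ideal R} (hI : I ^ 2 = ⊥) {M : ArrowSpace R (d₁ + d₂) (d₁ + d₂)}
    (hM : ∀ a b α i j, block₂₁ M a b α i j ∈ I) {x y : Δ} (p : Quiver.Path y x) :
    (pathMatrix M p).submatrix (Fin.natAdd (d₁ x)) (Fin.castAdd (d₂ y)) =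
      pathDelta (block₁₁ M) (block₂₁ M) (block₂₂ M) p := by
  induction p with
  | nil =>
    ext i j
    simp [pathMatrix, pathDelta, Matrix.one_apply, Fin.ext_iff]; omega
  | @cons b c p α ih =>
    simp only [pathMatrix, pathDelta]
    refine (submatrix_mul_fin (m := d₁ b) (n := d₂ b) _ _ _ _).trans ?_
    rw [ih]
    congr 1
    refine mul_eq_mul_of_sq_zero hI (fun i j => hM b c α i j) ?_
    let π := Ideal.Quotient.mkₐ k' I
    have hu : IsUpper (fun a b α => (M a b α).map π) := fun a b α i j =>
      Ideal.Quotient.eq_zero_iff_mem.2 (hM a b α i j)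
    have h := (pathMatrix_blocks_of_isUpper hu p).2.1
    rw [← map_pathMatrix π M p] at h
    exact h.trans (map_pathMatrix π (block₁₁ M) p).symm

/-- The `k`-linear extension of `pathDelta` to combinations of paths. -/
def combDelta (x y : Δ) : (Quiver.Path y x →₀ k) →ₗ[k] Matrix (Fin (d₂ x)) (Fin (d₁ y)) R :=
  Finsupp.linearCombination k fun p => pathDelta A C D p

lemma combDelta_single {x y : Δ} (p : Quiver.Path y x) (c : k) :
    combDelta A C D x y (Finsupp.single p c) = c • pathDelta A C D p :=
  Finsupp.linearCombination_single _ _ _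

lemma combMatrix_single {d : Δ → ℕ} (M : ArrowSpace R d d) {x y : Δ} (p : Quiver.Path y x)
    (c : k) : combMatrix M x y (Finsupp.single p c) = c • pathMatrix M p :=
  Finsupp.linearCombination_single _ _ _

lemma combDelta_add (C' : ArrowSpace R d₁ d₂) {x y : Δ} (f : Quiver.Path y x →₀ k) :
    combDelta A (C + C') D x y f = combDelta A C D x y f + combDelta A C' D x y f := by
  induction f using Finsupp.induction_linear with
  | zero => simp
  | add f g hf hg =>
    simp only [map_add, hf, hg]
    abel
  | single p c => simp only [combDelta_single, pathDelta_add, smul_add]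

lemma combDelta_smul (c : R) {x y : Δ} (f : Quiver.Path y x →₀ k) :
    combDelta A (c • C) D x y f = c • combDelta A C D x y f := by
  induction f using Finsupp.induction_linear with
  | zero => simp
  | add f g hf hg => simp only [map_add, hf, hg, smul_add]
  | single p a => simp only [combDelta_single, pathDelta_smul, smul_comm a c]

/-- The source of `δ∂ = 0`: both terms vanish when `A` and `D` satisfy the relations. -/
lemma combDelta_cobd (h : VertexSpace R d₁ d₂) {x y : Δ} (f : Quiver.Path y x →₀ k) :
    combDelta A (cobd A D h) D x y f = h x * combMatrix A x y f - combMatrix D x y f * h y := by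
  induction f using Finsupp.induction_linear with
  | zero => simp
  | add f g hf hg =>
    simp only [map_add, hf, hg, Matrix.mul_add, Matrix.add_mul]
    abel
  | single p a =>
    simp only [combDelta_single, combMatrix_single, pathDelta_cobd, smul_sub, Matrix.mul_smul,
      Matrix.smul_mul]

lemma map_combDelta (φ : R →ₐ[k] S) {x y : Δ} (f : Quiver.Path y x →₀ k) :
    (combDelta A C D x y f).map φ = combDelta (fun a b α => (A a b α).map φ)
      (fun a b α => (C a b α).map φ) (fun a b α => (D a b α).map φ) x y f := by
  induction f using Finsupp.induction_linear with
  | zero => simp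
  | add f g hf hg => simp only [map_add, ← hf, ← hg, Matrix.map_add φ (map_add φ)]
  | single p a =>
    simp only [combDelta_single, ← map_pathDelta A C D φ p]
    ext i j
    simp

lemma combMatrix_blocks_of_isUpper {M : ArrowSpace R (d₁ + d₂) (d₁ + d₂)} (hM : IsUpper M)
    {x y : Δ} (f : Quiver.Path y x →₀ k) :
    (combMatrix M x y f).submatrix (Fin.castAdd (d₂ x)) (Fin.castAdd (d₂ y)) =
      combMatrix (block₁₁ M) x y f ∧
    (combMatrix M x y f).submatrix (Fin.natAdd (d₁ x)) (Fin.natAdd (d₁ y)) =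
      combMatrix (block₂₂ M) x y f := by
  induction f using Finsupp.induction_linear with
  | zero => simp [Matrix.submatrix_zero]
  | add f g hf hg =>
    simp only [map_add]
    exact ⟨congrArg₂ (· + ·) hf.1 hg.1, congrArg₂ (· + ·) hf.2 hg.2⟩
  | single p a =>
    simp only [combMatrix_single]
    exact ⟨congrArg (a • ·) (pathMatrix_blocks_of_isUpper hM p).2.1,
      congrArg (a • ·) (pathMatrix_blocks_of_isUpper hM p).2.2⟩

lemma block₂₁_combMatrix {I : Ideal R} (hI : I ^ 2 = ⊥) {M : ArrowSpace R (d₁ + d₂) (d₁ + d₂)}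
    (hM : ∀ a b α i j, block₂₁ M a b α i j ∈ I) {x y : Δ} (f : Quiver.Path y x →₀ k) :
    (combMatrix M x y f).submatrix (Fin.natAdd (d₁ x)) (Fin.castAdd (d₂ y)) =
      combDelta (block₁₁ M) (block₂₁ M) (block₂₂ M) x y f := by
  induction f using Finsupp.induction_linear with
  | zero => simp [Matrix.submatrix_zero]
  | add f g hf hg =>
    simp only [map_add]
    exact congrArg₂ (· + ·) hf hg
  | single p a =>
    simp only [combMatrix_single, combDelta_single]
    exact congrArg (a • ·) (block₂₁_pathMatrix k hI hM p)

lemma combMatrix_lowerTri {x y : Δ} (f : Quiver.Path y x →₀ k) :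
    combMatrix (lowerTri A C D) x y f = Matrix.reindex finSumFinEquiv finSumFinEquiv
      (Matrix.fromBlocks (combMatrix A x y f) 0 (combDelta A C D x y f) (combMatrix D x y f)) := by
  induction f using Finsupp.induction_linear with
  | zero => simp
  | add f g hf hg =>
    simp only [map_add, hf, hg]
    ext i j
    obtain ⟨i, rfl⟩ := finSumFinEquiv.surjective i
    obtain ⟨j, rfl⟩ := finSumFinEquiv.surjective j
    rcases i with i | i <;> rcases j with j | j <;> simp
  | single p a =>
    simp only [combMatrix_single, combDelta_single, pathMatrix_lowerTri]
    ext i j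
    obtain ⟨i, rfl⟩ := finSumFinEquiv.surjective i
    obtain ⟨j, rfl⟩ := finSumFinEquiv.surjective j
    rcases i with i | i <;> rcases j with j | j <;> simp

variable [Fintype Δ]

lemma BoundQuiver.IsRep.map {B : BoundQuiver k Δ} {d : Δ → ℕ} {M : ArrowSpace R d d}
    (hM : B.IsRep M) (φ : R →ₐ[k] S) : B.IsRep (fun a b α => (M a b α).map φ) := by
  intro ρ hρ x y
  rw [← map_combMatrix, hM ρ hρ x y]
  ext
  simp

lemma BoundQuiver.IsRep.blocks_of_isUpper {B : BoundQuiver k Δ}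
    {M : ArrowSpace R (d₁ + d₂) (d₁ + d₂)} (hM : B.IsRep M) (hu : IsUpper M) :
    B.IsRep (block₁₁ M) ∧ B.IsRep (block₂₂ M) := by
  constructor <;> intro ρ hρ x y
  · rw [← (combMatrix_blocks_of_isUpper hu _).1, hM ρ hρ x y]; rfl
  · rw [← (combMatrix_blocks_of_isUpper hu _).2, hM ρ hρ x y]; rfl

lemma isRep_lowerTri {B : BoundQuiver k Δ} {A : ArrowSpace R d₁ d₁} {C : ArrowSpace R d₁ d₂}
    {D : ArrowSpace R d₂ d₂} (hA : B.IsRep A) (hD : B.IsRep D)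
    (hC : ∀ ρ ∈ B.rels, ∀ x y, combDelta A C D x y (ρ x y) = 0) : B.IsRep (lowerTri A C D) := by
  intro ρ hρ x y
  rw [combMatrix_lowerTri, hA ρ hρ, hD ρ hρ, hC ρ hρ, Matrix.fromBlocks_zero]
  simp

/-- The lower left block of a representation satisfies the cocycle condition, if it is small. -/
lemma combDelta_eq_zero {B : BoundQuiver k Δ} {I : Ideal R} (hI : I ^ 2 = ⊥)
    {M : ArrowSpace R (d₁ + d₂) (d₁ + d₂)} (hM : ∀ a b α i j, block₂₁ M a b α i j ∈ I)
    (hrep : B.IsRep M) (ρ : PathAlgebra k Δ) (hρ : ρ ∈ B.rels) (x y : Δ) :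
    combDelta (block₁₁ M) (block₂₁ M) (block₂₂ M) x y (ρ x y) = 0 := by
  rw [← block₂₁_combMatrix hI hM, hrep ρ hρ x y]
  rfl

/-- Coboundaries of small cochains satisfy the cocycle condition. -/
lemma combDelta_cobd_eq_zero {B : BoundQuiver k Δ} {I : Ideal R} (hI : I ^ 2 = ⊥)
    {M : ArrowSpace R (d₁ + d₂) (d₁ + d₂)} (hM : ∀ a b α i j, block₂₁ M a b α i j ∈ I)
    (hrep : B.IsRep M) {h : VertexSpace R d₁ d₂} (hh : ∀ x i j, h x i j ∈ I)
    (ρ : PathAlgebra k Δ) (hρ : ρ ∈ B.rels) (x y : Δ) :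
    combDelta (block₁₁ M) (cobd (block₁₁ M) (block₂₂ M) h) (block₂₂ M) x y (ρ x y) = 0 := by
  let π := Ideal.Quotient.mkₐ k I
  have hu : IsUpper (fun a b α => (M a b α).map π) := fun a b α i j =>
    Ideal.Quotient.eq_zero_iff_mem.2 (hM a b α i j)
  -- The diagonal blocks satisfy the relations only modulo `I`; the error has entries in `I` and is
  -- killed by `h`.
  obtain ⟨h₁, h₂⟩ := (hrep.map π).blocks_of_isUpper hu
  have e₁ : (combMatrix (block₁₁ M) x y (ρ x y)).map (Ideal.Quotient.mk I) = 0 :=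
    (map_combMatrix π (block₁₁ M) (ρ x y)).trans (h₁ ρ hρ x y)
  have e₂ : (combMatrix (block₂₂ M) x y (ρ x y)).map (Ideal.Quotient.mk I) = 0 :=
    (map_combMatrix π (block₂₂ M) (ρ x y)).trans (h₂ ρ hρ x y)
  rw [combDelta_cobd, mul_eq_zero_of_sq_zero hI (hh x) e₁, mul_eq_zero_of_sq_zero' hI e₂ (hh y),
    sub_zero]

end Blocks

end QuiverRep

/-! ### Vanishing of `Ext¹` and cocycles -/

open CategoryTheory in
/-- If `Ext¹(X, Y) = 0`, then every extension of `X` by `Y` splits. -/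
lemma LinearMap.exists_section_of_ext {Λ X Y E : Type u} [Ring Λ] [AddCommGroup X] [Module Λ X]
    [AddCommGroup Y] [Module Λ Y] [AddCommGroup E] [Module Λ E]
    (hExt : Subsingleton (Abelian.Ext.{u} (ModuleCat.of.{u} Λ X) (ModuleCat.of.{u} Λ Y) 1))
    (f : Y →ₗ[Λ] E) (g : E →ₗ[Λ] X) (hf : Function.Injective f) (hg : Function.Surjective g)
    (hfg : Function.Exact f g) : ∃ s : X →ₗ[Λ] E, ∀ x, g (s x) = x := by
  let S : ShortComplex (ModuleCat.{u} Λ) :=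
    ShortComplex.mk (ModuleCat.ofHom f) (ModuleCat.ofHom g) (by
      ext y
      exact (hfg (f y)).2 ⟨y, rfl⟩)
  have hS : S.ShortExact :=
    { exact := (ShortComplex.ShortExact.moduleCat_exact_iff_function_exact S).2 hfg
      mono_f := (ModuleCat.mono_iff_injective _).2 hf
      epi_g := (ModuleCat.epi_iff_surjective _).2 hg }
  -- The connecting map sends the identity of `X` into `Ext¹(X, Y) = 0`, so the identity lifts
  -- through `g`.
  obtain ⟨x₂, hx₂⟩ := Abelian.Ext.covariant_sequence_exact₃ (ModuleCat.of Λ X) hS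
    (Abelian.Ext.mk₀ (𝟙 (ModuleCat.of Λ X))) (zero_add 1) (Subsingleton.elim _ _)
  obtain ⟨s, rfl⟩ := (Abelian.Ext.mk₀_bijective _ _).2 x₂
  rw [Abelian.Ext.mk₀_comp_mk₀] at hx₂
  have h := (Abelian.Ext.mk₀_bijective _ _).1 hx₂
  exact ⟨s.hom, fun x => congrArg (fun t => t.hom x) h⟩

namespace QuiverRep

section

variable {k : Type u} {Δ : Type v} [Field k] [Quiver.{w} Δ]

lemma ofPath_apply_self {x y : Δ} (p : Quiver.Path y x) :
    ofPath k p x y = Finsupp.single p 1 := by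
  simp [ofPath]

lemma ofPath_apply_of_ne {x y z : Δ} (p : Quiver.Path y x) (h : z ≠ y) :
    ofPath k p x z = 0 := by
  simp [ofPath, h]

lemma ofPath_apply_of_ne' {x y t z : Δ} (p : Quiver.Path y x) (h : t ≠ x) :
    ofPath k p t z = 0 := by
  simp [ofPath, h]

lemma reindex_fromBlocks_mulVec_castAdd {m n m' n' : ℕ} (A : Matrix (Fin m) (Fin m') k)
    (C : Matrix (Fin n) (Fin m') k) (D : Matrix (Fin n) (Fin n') k) (w : Fin (m' + n') → k)
    (i : Fin m) :
    (Matrix.reindex finSumFinEquiv finSumFinEquiv (Matrix.fromBlocks A 0 C D)).mulVec w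
      (Fin.castAdd n i) = A.mulVec (fun j => w (Fin.castAdd n' j)) i := by
  simp [Matrix.mulVec, dotProduct, Fin.sum_univ_add]

lemma reindex_fromBlocks_mulVec_natAdd {m n m' n' : ℕ} (A : Matrix (Fin m) (Fin m') k)
    (C : Matrix (Fin n) (Fin m') k) (D : Matrix (Fin n) (Fin n') k) (w : Fin (m' + n') → k)
    (i : Fin n) :
    (Matrix.reindex finSumFinEquiv finSumFinEquiv (Matrix.fromBlocks A 0 C D)).mulVec w
      (Fin.natAdd m i) = C.mulVec (fun j => w (Fin.castAdd n' j)) i +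
        D.mulVec (fun j => w (Fin.natAdd m' j)) i := by
  simp [Matrix.mulVec, dotProduct, Fin.sum_univ_add]

variable [Fintype Δ] {B : BoundQuiver k Δ} {d d' : Δ → ℕ} {M : ArrowSpace k d d}
  {M' : ArrowSpace k d' d'}

lemma pathAction_apply (f : PathAlgebra k Δ) (v : ∀ x : Δ, Fin (d x) → k) (x : Δ) :
    pathAction M f v x = ∑ y, (combMatrix M x y (f x y)).mulVec (v y) := by
  change (LinearMap.pi fun x => ∑ y, (combMatrix M x y (f x y)).mulVecLin ∘ₗ
    LinearMap.proj y) v x = _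
  simp

lemma pathAction_ofPath_apply {x y : Δ} (p : Quiver.Path y x) (v : ∀ x : Δ, Fin (d x) → k) :
    pathAction M (ofPath k p) v x = (pathMatrix M p).mulVec (v y) := by
  rw [pathAction_apply, Finset.sum_eq_single y]
  · rw [ofPath_apply_self, combMatrix_single, one_smul]
  · intro z _ hz
    rw [ofPath_apply_of_ne p hz, map_zero, Matrix.zero_mulVec]
  · simp

lemma pathAction_ofPath_single [DecidableEq Δ] {x y : Δ} (p : Quiver.Path y x)
    (u : Fin (d y) → k) :
    pathAction M (ofPath k p) (Pi.single y u) = Pi.single x ((pathMatrix M p).mulVec u) := by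
  funext t
  by_cases h : t = x
  · subst h
    rw [pathAction_ofPath_apply, Pi.single_eq_same, Pi.single_eq_same]
  · rw [pathAction_apply, Pi.single_eq_of_ne h]
    refine Finset.sum_eq_zero fun z _ => ?_
    rw [ofPath_apply_of_ne' p h, map_zero, Matrix.zero_mulVec]

lemma pathAction_smul_one (c : k) (v : ∀ x : Δ, Fin (d x) → k) :
    pathAction M (c • (1 : PathAlgebra k Δ)) v = c • v := by
  funext x
  rw [pathAction_apply, Finset.sum_eq_single x]
  · rw [PathAlgebra.smul_apply, PathAlgebra.one_apply_self, map_smul, combMatrix_single]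
    simp [pathMatrix, Matrix.smul_mulVec]
  · intro z _ hz
    rw [PathAlgebra.smul_apply, PathAlgebra.one_apply_ne hz]
    simp
  · simp

/-- A map of representations as a homomorphism of modules. -/
def BoundQuiver.moduleHom (hM : B.IsRep M) (hM' : B.IsRep M')
    (φ : (∀ x : Δ, Fin (d x) → k) →ₗ[k] (∀ x : Δ, Fin (d' x) → k))
    (h : ∀ f v, φ (pathAction M f v) = pathAction M' f (φ v)) :
    B.ModuleOf M hM →ₗ[B.Alg] B.ModuleOf M' hM' where
  toFun := φ
  map_add' := φ.map_add
  map_smul' l v := by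
    obtain ⟨l, rfl⟩ := Ideal.Quotient.mk_surjective l
    exact h l v

/-- The `k`-linear map underlying a homomorphism of modules. -/
def BoundQuiver.underlying (hM : B.IsRep M) (hM' : B.IsRep M')
    (s : B.ModuleOf M hM →ₗ[B.Alg] B.ModuleOf M' hM') :
    (∀ x : Δ, Fin (d x) → k) →ₗ[k] (∀ x : Δ, Fin (d' x) → k) where
  toFun := s
  map_add' := s.map_add
  map_smul' c v := by
    -- Scalars act through the class of `c • 1`, so `Λ`-linearity contains `k`-linearity.
    have h := s.map_smul (Ideal.Quotient.mk (TwoSidedIdeal.span B.rels).asIdeal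
      (c • (1 : PathAlgebra k Δ))) v
    refine (congrArg s (pathAction_smul_one (M := M) c v).symm).trans (h.trans ?_)
    exact pathAction_smul_one (M := M') c (s v)

lemma BoundQuiver.underlying_pathAction (hM : B.IsRep M) (hM' : B.IsRep M')
    (s : B.ModuleOf M hM →ₗ[B.Alg] B.ModuleOf M' hM') (f : PathAlgebra k Δ)
    (v : ∀ x : Δ, Fin (d x) → k) :
    BoundQuiver.underlying hM hM' s (pathAction M f v) =
      pathAction M' f (BoundQuiver.underlying hM hM' s v) :=
  s.map_smul (Ideal.Quotient.mk (TwoSidedIdeal.span B.rels).asIdeal f) v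

end

section Cocycles

/-- The inclusion of the second summand of `k^{d₁ + d₂}`. -/
def sndIncl {k : Type u} {Δ : Type v} [Field k] (d₁ d₂ : Δ → ℕ) :
    (∀ x : Δ, Fin (d₂ x) → k) →ₗ[k] (∀ x : Δ, Fin ((d₁ + d₂) x) → k) :=
  LinearMap.pi fun x => (LinearMap.pi fun i : Fin (d₁ x + d₂ x) =>
    Fin.addCases (motive := fun _ => (Fin (d₂ x) → k) →ₗ[k] k) (fun _ => 0)
      (fun j => LinearMap.proj j) i) ∘ₗ LinearMap.proj x

lemma sndIncl_castAdd {k : Type u} {Δ : Type v} [Field k] {d₁ d₂ : Δ → ℕ}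
    (v : ∀ x : Δ, Fin (d₂ x) → k) (x : Δ) (i : Fin (d₁ x)) :
    sndIncl d₁ d₂ v x (Fin.castAdd (d₂ x) i) = 0 := by
  simp [sndIncl]

lemma sndIncl_natAdd {k : Type u} {Δ : Type v} [Field k] {d₁ d₂ : Δ → ℕ}
    (v : ∀ x : Δ, Fin (d₂ x) → k) (x : Δ) (i : Fin (d₂ x)) :
    sndIncl d₁ d₂ v x (Fin.natAdd (d₁ x) i) = v x i := by
  simp [sndIncl]

/-- The projection of `k^{d₁ + d₂}` onto the first summand. -/
def fstProj {k : Type u} {Δ : Type v} [Field k] (d₁ d₂ : Δ → ℕ) :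
    (∀ x : Δ, Fin ((d₁ + d₂) x) → k) →ₗ[k] (∀ x : Δ, Fin (d₁ x) → k) where
  toFun v x i := v x (Fin.castAdd (d₂ x) i)
  map_add' _ _ := rfl
  map_smul' _ _ := rfl

variable {k : Type u} {Δ : Type u} [Field k] [Quiver.{u} Δ] [Fintype Δ] {B : BoundQuiver k Δ}
  {d₁ d₂ : Δ → ℕ}

open Classical in
/-- If `Ext¹(U, V) = 0`, then every cocycle is a coboundary. -/
theorem mem_coboundaries_of_ext {U : ArrowSpace k d₁ d₁} {V : ArrowSpace k d₂ d₂}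
    (hU : B.IsRep U) (hV : B.IsRep V)
    (hExt : Subsingleton (CategoryTheory.Abelian.Ext.{u}
      (ModuleCat.of.{u} B.Alg (B.ModuleOf U hU)) (ModuleCat.of.{u} B.Alg (B.ModuleOf V hV)) 1))
    {C : ArrowSpace k d₁ d₂} (hC : ∀ ρ ∈ B.rels, ∀ x y, combDelta U C V x y (ρ x y) = 0) :
    C ∈ coboundaries U V := by
  -- The cocycle condition makes `[U 0; C V]` a representation, the middle term of an extension of
  -- `U` by `V`.
  have hM := isRep_lowerTri hU hV hC
  let f := BoundQuiver.moduleHom hV hM (sndIncl d₁ d₂) (fun l v => by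
    funext x i
    rw [pathAction_apply]
    simp only [combMatrix_lowerTri]
    rw [Finset.sum_apply]
    refine Fin.addCases (fun i => ?_) (fun i => ?_) i
    · rw [sndIncl_castAdd, eq_comm]
      refine Finset.sum_eq_zero fun y _ => ?_
      refine (reindex_fromBlocks_mulVec_castAdd _ _ _ _ i).trans ?_
      have : (fun j => sndIncl d₁ d₂ v y (Fin.castAdd (d₂ y) j)) = 0 :=
        funext fun j => sndIncl_castAdd v y j
      rw [this, Matrix.mulVec_zero]
      rfl
    · rw [sndIncl_natAdd, pathAction_apply, Finset.sum_apply]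
      refine Finset.sum_congr rfl fun y _ => ?_
      refine Eq.trans ?_ (reindex_fromBlocks_mulVec_natAdd _ _ _ _ i).symm
      have h₁ : (fun j => sndIncl d₁ d₂ v y (Fin.castAdd (d₂ y) j)) = 0 :=
        funext fun j => sndIncl_castAdd v y j
      have h₂ : (fun j => sndIncl d₁ d₂ v y (Fin.natAdd (d₁ y) j)) = v y :=
        funext fun j => sndIncl_natAdd v y j
      rw [h₁, h₂, Matrix.mulVec_zero, Pi.zero_apply, zero_add])
  let g := BoundQuiver.moduleHom hM hU (fstProj d₁ d₂) (fun l v => by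
    funext x i
    change pathAction (lowerTri U C V) l v x (Fin.castAdd (d₂ x) i) = _
    rw [pathAction_apply, pathAction_apply]
    simp only [combMatrix_lowerTri]
    rw [Finset.sum_apply, Finset.sum_apply]
    exact Finset.sum_congr rfl fun y _ => reindex_fromBlocks_mulVec_castAdd _ _ _ _ i)
  have hf : Function.Injective f := by
    intro v v' h
    funext x i
    have := congrFun (congrFun h x) (Fin.natAdd (d₁ x) i)
    exact (sndIncl_natAdd v x i).symm.trans (this.trans (sndIncl_natAdd v' x i))
  have hg : Function.Surjective g := by
    intro v
    refine ⟨fun x => Fin.append (v x) (0 : Fin (d₂ x) → k), ?_⟩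
    funext x i
    exact Fin.append_left _ _ i
  have hfg : Function.Exact f g := by
    intro v
    constructor
    · intro h
      refine ⟨fun x i => v x (Fin.natAdd (d₁ x) i), ?_⟩
      funext x i
      refine Fin.addCases (fun i => ?_) (fun i => ?_) i
      · exact (sndIncl_castAdd _ x i).trans (congrFun (congrFun h x) i).symm
      · exact sndIncl_natAdd _ x i
    · rintro ⟨v, rfl⟩
      funext x i
      exact sndIncl_castAdd v x i
  obtain ⟨s, hs⟩ := LinearMap.exists_section_of_ext hExt f g hf hg hfg
  let s' := BoundQuiver.underlying hU hM s
  have hs' : ∀ v x i, s' v x (Fin.castAdd (d₂ x) i) = v x i := fun v x i =>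
    congrFun (congrFun (hs v) x) i
  -- The section has the form `(1, σ)`; only the part of `σ` from each vertex to itself is needed.
  let σ : ∀ x, (Fin (d₁ x) → k) →ₗ[k] (Fin (d₂ x) → k) := fun x =>
    LinearMap.pi fun i => LinearMap.proj (φ := fun _ : Fin ((d₁ + d₂) x) => k)
      (Fin.natAdd (d₁ x) i) ∘ₗ LinearMap.proj x ∘ₗ s' ∘ₗ
        LinearMap.single k (fun x => Fin (d₁ x) → k) x
  have hσ : ∀ x u i, σ x u i = s' (Pi.single x u) x (Fin.natAdd (d₁ x) i) := fun _ _ _ => rfl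
  refine ⟨fun x => LinearMap.toMatrix' (σ x), ?_⟩
  funext a b α
  change LinearMap.toMatrix' (σ b) * U a b α - V a b α * LinearMap.toMatrix' (σ a) = C a b α
  rw [sub_eq_iff_eq_add]
  apply Matrix.ext_of_mulVec_single
  intro j
  set u : Fin (d₁ a) → k := Pi.single j 1
  rw [Matrix.add_mulVec, ← Matrix.mulVec_mulVec, ← Matrix.mulVec_mulVec,
    LinearMap.toMatrix'_mulVec, LinearMap.toMatrix'_mulVec]
  funext i
  rw [hσ]
  -- Compatibility of the section with the arrow `α`, read off in the lower component, is `σ U = C +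
  -- V σ`.
  have h := BoundQuiver.underlying_pathAction hU hM s (ofPath k α.toPath) (Pi.single a u)
  rw [pathAction_ofPath_single] at h
  have h' := congrFun (congrFun h b) (Fin.natAdd (d₁ b) i)
  rw [pathAction_ofPath_apply] at h'
  have hα : ∀ {d : Δ → ℕ} (M : ArrowSpace k d d), pathMatrix M α.toPath = M a b α := fun M => by
    simp [Quiver.Hom.toPath, pathMatrix]
  rw [hα, hα] at h'
  refine h'.trans ((reindex_fromBlocks_mulVec_natAdd _ _ _ _ i).trans ?_)
  have h₁ : (fun j => s' (Pi.single a u) a (Fin.castAdd (d₂ a) j)) = u := by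
    funext j
    rw [hs', Pi.single_eq_same]
  exact congrArg₂ (· + ·) (congrArg (fun w => (C a b α).mulVec w i) h₁) rfl

end Cocycles

/-! ### A contracting homotopy and its deformation -/

/-- The coordinates of the affine space `𝔸^{d₁,d₂}`. -/
abbrev ArrowCoord {Δ : Type v} [Quiver.{w} Δ] (d₁ d₂ : Δ → ℕ) :=
  Σ (a : Δ) (b : Δ) (_ : a ⟶ b), Fin (d₂ b) × Fin (d₁ a)

/-- The coordinate isomorphism. -/
def arrowCoordEquiv {Δ : Type v} [Quiver.{w} Δ] (R : Type*) [CommRing R] (d₁ d₂ : Δ → ℕ) :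
    ArrowSpace R d₁ d₂ ≃ₗ[R] (ArrowCoord d₁ d₂ → R) where
  toFun C c := C c.1 c.2.1 c.2.2.1 c.2.2.2.1 c.2.2.2.2
  invFun v a b α := Matrix.of fun i j => v ⟨a, b, α, i, j⟩
  map_add' _ _ := rfl
  map_smul' _ _ := rfl
  left_inv _ := rfl
  right_inv _ := rfl

@[simp]
lemma arrowCoordEquiv_apply {Δ : Type v} [Quiver.{w} Δ] {R : Type*} [CommRing R] {d₁ d₂ : Δ → ℕ}
    (C : ArrowSpace R d₁ d₂) (c : ArrowCoord d₁ d₂) :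
    arrowCoordEquiv R d₁ d₂ C c = C c.1 c.2.1 c.2.2.1 c.2.2.2.1 c.2.2.2.2 := rfl

@[simp]
lemma arrowCoordEquiv_symm_apply {Δ : Type v} [Quiver.{w} Δ] {R : Type*} [CommRing R]
    {d₁ d₂ : Δ → ℕ} (v : ArrowCoord d₁ d₂ → R) (a b : Δ) (α : a ⟶ b) (i : Fin (d₂ b))
    (j : Fin (d₁ a)) : (arrowCoordEquiv R d₁ d₂).symm v a b α i j = v ⟨a, b, α, i, j⟩ := rfl

/-- Positions in the matrices attached to the relations by `combDelta`. -/
abbrev RelCoord {k : Type u} {Δ : Type v} [Field k] [Quiver.{w} Δ] [Fintype Δ]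
    (B : BoundQuiver k Δ) (d₁ d₂ : Δ → ℕ) :=
  Σ (_ : B.rels) (x : Δ) (y : Δ), Fin (d₂ x) × Fin (d₁ y)

section

variable {k : Type u} {Δ : Type v} [Field k] [Quiver.{w} Δ] [Fintype Δ] {B : BoundQuiver k Δ}
  {R S : Type*} [CommRing R] [CommRing S] [Algebra k R] [Algebra k S] {d₁ d₂ : Δ → ℕ}

/-- The entries of the matrices attached to the relations, as linear functions. -/
def relFun (A : ArrowSpace R d₁ d₁) (D : ArrowSpace R d₂ d₂) (t : RelCoord B d₁ d₂) :
    ArrowSpace R d₁ d₂ →ₗ[R] R where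
  toFun C := combDelta A C D t.2.1 t.2.2.1 (t.1.1 t.2.1 t.2.2.1) t.2.2.2.1 t.2.2.2.2
  map_add' C C' := by rw [combDelta_add]; rfl
  map_smul' c C := by rw [combDelta_smul]; rfl

variable [∀ a b : Δ, Fintype (a ⟶ b)]

/-- The base change to `R` of the linear map with values `X e` on the basis. -/
def baseChangeMap (R : Type*) [CommRing R] [Algebra k R]
    (X : ArrowCoord d₁ d₂ → VertexSpace k d₁ d₂) :
    ArrowSpace R d₁ d₂ →ₗ[R] VertexSpace R d₁ d₂ where
  toFun C x := ∑ e, arrowCoordEquiv R d₁ d₂ C e • (X e x).map (algebraMap k R)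
  map_add' C C' := by
    funext x
    simp only [map_add, Pi.add_apply, add_smul, Finset.sum_add_distrib]
  map_smul' c C := by
    funext x
    simp only [map_smul, Pi.smul_apply, smul_assoc, Finset.smul_sum, RingHom.id_apply]

/-- The operator `∂ X + Y δ` for the base changes of linear maps `X` and `Y`. -/
def homotopyMap (X : ArrowCoord d₁ d₂ → VertexSpace k d₁ d₂)
    (Y : ArrowCoord d₁ d₂ → RelCoord B d₁ d₂ →₀ k) (A : ArrowSpace R d₁ d₁)
    (D : ArrowSpace R d₂ d₂) : ArrowSpace R d₁ d₂ →ₗ[R] ArrowSpace R d₁ d₂ :=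
  cobd A D ∘ₗ baseChangeMap R X + (arrowCoordEquiv R d₁ d₂).symm.toLinearMap ∘ₗ
    LinearMap.pi fun e => (Y e).sum fun t c => algebraMap k R c • relFun A D t

lemma homotopyMap_apply (X : ArrowCoord d₁ d₂ → VertexSpace k d₁ d₂)
    (Y : ArrowCoord d₁ d₂ → RelCoord B d₁ d₂ →₀ k) (A : ArrowSpace R d₁ d₁)
    (D : ArrowSpace R d₂ d₂) (C : ArrowSpace R d₁ d₂) :
    homotopyMap X Y A D C = cobd A D (baseChangeMap R X C) + (arrowCoordEquiv R d₁ d₂).symm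
      fun e => (Y e).sum fun t c => algebraMap k R c * relFun A D t C := by
  simp only [homotopyMap, LinearMap.add_apply, LinearMap.comp_apply]
  refine congrArg (_ + ·) (congrArg (arrowCoordEquiv R d₁ d₂).symm (funext fun e => ?_))
  simp [Finsupp.sum, Algebra.smul_def]

lemma map_baseChangeMap (φ : R →ₐ[k] S) (X : ArrowCoord d₁ d₂ → VertexSpace k d₁ d₂)
    (C : ArrowSpace R d₁ d₂) (x : Δ) : (baseChangeMap R X C x).map φ =
      baseChangeMap S X (fun a b α => (C a b α).map φ) x := by
  ext i j
  simp [baseChangeMap, Matrix.sum_apply]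

lemma map_homotopyMap (φ : R →ₐ[k] S) (X : ArrowCoord d₁ d₂ → VertexSpace k d₁ d₂)
    (Y : ArrowCoord d₁ d₂ → RelCoord B d₁ d₂ →₀ k) (A : ArrowSpace R d₁ d₁)
    (D : ArrowSpace R d₂ d₂) (C : ArrowSpace R d₁ d₂) :
    (fun a b α => (homotopyMap X Y A D C a b α).map φ) =
      homotopyMap X Y (fun a b α => (A a b α).map φ) (fun a b α => (D a b α).map φ)
        (fun a b α => (C a b α).map φ) := by
  rw [homotopyMap_apply, homotopyMap_apply]
  have hrel : ∀ t : RelCoord B d₁ d₂, φ (relFun A D t C) =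
      relFun (fun a b α => (A a b α).map φ) (fun a b α => (D a b α).map φ) t
        (fun a b α => (C a b α).map φ) := fun t =>
    congrFun (congrFun (map_combDelta A C D φ (t.1.1 t.2.1 t.2.2.1)) t.2.2.2.1) t.2.2.2.2
  funext a b α
  simp only [Pi.add_apply]
  rw [Matrix.map_add φ (map_add φ)]
  congr 1
  · simp only [cobd_apply]
    rw [Matrix.map_sub φ (map_sub φ), Matrix.map_mul, Matrix.map_mul, map_baseChangeMap,
      map_baseChangeMap]
  · ext i j
    simp [Finsupp.sum, hrel]

open Classical in
/-- The matrix of `homotopyMap`. -/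
def homotopyMatrix (X : ArrowCoord d₁ d₂ → VertexSpace k d₁ d₂)
    (Y : ArrowCoord d₁ d₂ → RelCoord B d₁ d₂ →₀ k) (A : ArrowSpace R d₁ d₁)
    (D : ArrowSpace R d₂ d₂) : Matrix (ArrowCoord d₁ d₂) (ArrowCoord d₁ d₂) R :=
  LinearMap.toMatrix' ((arrowCoordEquiv R d₁ d₂).toLinearMap ∘ₗ homotopyMap X Y A D ∘ₗ
    (arrowCoordEquiv R d₁ d₂).symm.toLinearMap)

/-- With `X` and `Y` fixed over `k`, the matrix is natural in the point, so one polynomial computes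
its determinant at all points. -/
lemma map_homotopyMatrix (φ : R →ₐ[k] S) (X : ArrowCoord d₁ d₂ → VertexSpace k d₁ d₂)
    (Y : ArrowCoord d₁ d₂ → RelCoord B d₁ d₂ →₀ k) (A : ArrowSpace R d₁ d₁)
    (D : ArrowSpace R d₂ d₂) : (homotopyMatrix X Y A D).map φ =
      homotopyMatrix X Y (fun a b α => (A a b α).map φ) (fun a b α => (D a b α).map φ) := by
  classical
  ext e e'
  simp only [homotopyMatrix, Matrix.map_apply, LinearMap.toMatrix'_apply, LinearMap.comp_apply]
  have h := map_homotopyMap φ X Y A D ((arrowCoordEquiv R d₁ d₂).symm (Pi.single e' 1))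
  have h2 : (fun a b α => ((arrowCoordEquiv R d₁ d₂).symm (Pi.single e' 1) a b α).map φ) =
      (arrowCoordEquiv S d₁ d₂).symm (Pi.single e' 1) := by
    funext a b α
    ext i j
    simp [Pi.single_apply, apply_ite φ]
  rw [h2] at h
  exact congrArg (fun C => arrowCoordEquiv S d₁ d₂ C e) h

open Classical in
lemma homotopyMap_surjective {X : ArrowCoord d₁ d₂ → VertexSpace k d₁ d₂}
    {Y : ArrowCoord d₁ d₂ → RelCoord B d₁ d₂ →₀ k} {A : ArrowSpace R d₁ d₁}
    {D : ArrowSpace R d₂ d₂} (h : IsUnit (homotopyMatrix X Y A D).det) :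
    Function.Surjective (homotopyMap X Y A D) := by
  intro C
  obtain ⟨v, hv⟩ := (Matrix.mulVec_surjective_iff_isUnit.2
    ((Matrix.isUnit_iff_isUnit_det _).2 h)) (arrowCoordEquiv R d₁ d₂ C)
  rw [homotopyMatrix, LinearMap.toMatrix'_mulVec] at hv
  exact ⟨_, (arrowCoordEquiv R d₁ d₂).injective hv⟩

/-- A small cocycle is a small coboundary where `homotopyMap` is invertible. -/
lemma exists_cobd_eq {X : ArrowCoord d₁ d₂ → VertexSpace k d₁ d₂}
    {Y : ArrowCoord d₁ d₂ → RelCoord B d₁ d₂ →₀ k} {I : Ideal R} (hI : I ^ 2 = ⊥)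
    {M : ArrowSpace R (d₁ + d₂) (d₁ + d₂)} (hrep : B.IsRep M)
    (hM : ∀ a b α i j, block₂₁ M a b α i j ∈ I)
    (hT : Function.Surjective (homotopyMap X Y (block₁₁ M) (block₂₂ M))) :
    ∃ h : VertexSpace R d₁ d₂, (∀ x i j, h x i j ∈ I) ∧
      cobd (block₁₁ M) (block₂₂ M) h = block₂₁ M := by
  let small : Submodule R (VertexSpace R d₁ d₂) :=
    { carrier := {h | ∀ x i j, h x i j ∈ I}
      add_mem' := fun ha hb x i j => I.add_mem (ha x i j) (hb x i j)
      zero_mem' := fun _ _ _ => I.zero_mem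
      smul_mem' := fun c _ ha x i j => I.mul_mem_left c (ha x i j) }
  let N : Submodule R (ArrowSpace R d₁ d₂) := small.map (cobd (block₁₁ M) (block₂₂ M))
  let T := homotopyMap X Y (block₁₁ M) (block₂₂ M)
  suffices hN : block₂₁ M ∈ N by
    obtain ⟨h, hh, he⟩ := hN
    exact ⟨h, hh, he⟩
  have hsmall : ∀ C : ArrowSpace R d₁ d₂, (∀ a b α i j, C a b α i j ∈ I) →
      baseChangeMap R X C ∈ small := by
    intro C hC x i j
    simp only [baseChangeMap, LinearMap.coe_mk, AddHom.coe_mk, Matrix.sum_apply]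
    exact I.sum_mem fun e _ => I.mul_mem_right _ (hC _ _ _ _ _)
  -- On a small cocycle the summand `Yδ` vanishes, so `T` acts as `∂X` and lands in `N`.
  have hmem : ∀ C : ArrowSpace R d₁ d₂, (∀ a b α i j, C a b α i j ∈ I) →
      (∀ ρ ∈ B.rels, ∀ x y, combDelta (block₁₁ M) C (block₂₂ M) x y (ρ x y) = 0) →
      T C ∈ N := by
    intro C hC hδ
    refine ⟨baseChangeMap R X C, hsmall C hC, ?_⟩
    have h0 : ∀ t : RelCoord B d₁ d₂, relFun (block₁₁ M) (block₂₂ M) t C = 0 := fun t =>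
      congrFun (congrFun (hδ t.1.1 t.1.2 t.2.1 t.2.2.1) t.2.2.2.1) t.2.2.2.2
    change _ = homotopyMap X Y (block₁₁ M) (block₂₂ M) C
    rw [homotopyMap_apply]
    simp only [h0, mul_zero, Finsupp.sum_fun_zero]
    exact (add_zero _).symm
  have hTN : N ≤ N.comap T := by
    rintro _ ⟨h, hh, rfl⟩
    refine hmem _ (fun a b α i j => ?_) fun ρ hρ x y => combDelta_cobd_eq_zero hI hM hrep hh ρ hρ x y
    rw [cobd_apply, Matrix.sub_apply, Matrix.mul_apply, Matrix.mul_apply]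
    exact I.sub_mem (I.sum_mem fun l _ => I.mul_mem_right _ (hh _ _ _))
      (I.sum_mem fun l _ => I.mul_mem_left _ (hh _ _ _))
  have hTC : T (block₂₁ M) ∈ N := hmem _ hM (combDelta_eq_zero hI hM hrep)
  -- The induced endomorphism of the finitely generated quotient by `N` is surjective, hence
  -- injective; as it kills the class of the lower left block, that class is zero.
  let Tq := N.mapQ N T hTN
  have hsurj : Function.Surjective Tq := by
    intro q
    obtain ⟨C, rfl⟩ := N.mkQ_surjective q
    obtain ⟨C', rfl⟩ := hT C
    exact ⟨N.mkQ C', rfl⟩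
  have hfin : Module.Finite R (ArrowSpace R d₁ d₂) :=
    Module.Finite.equiv (arrowCoordEquiv R d₁ d₂).symm
  have hinj := OrzechProperty.injective_of_surjective_endomorphism Tq hsurj
  rw [← Submodule.Quotient.mk_eq_zero]
  apply hinj
  rw [map_zero]
  exact (Submodule.Quotient.mk_eq_zero N).2 hTC

/-- Linear algebra over a field: `X` extends a section of `∂` onto its image, so `1 - ∂X` vanishes
on coboundaries, hence on `ker δ`, and therefore factors through δ as `Yδ`. Each coordinate involves
finitely many relation entries, so the set of relations may be infinite. -/
lemma exists_homotopyMap_eq_id {U : ArrowSpace k d₁ d₁} {V : ArrowSpace k d₂ d₂}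
    (hcoc : ∀ C : ArrowSpace k d₁ d₂,
      (∀ ρ ∈ B.rels, ∀ x y, combDelta U C V x y (ρ x y) = 0) → C ∈ coboundaries U V) :
    ∃ (X : ArrowCoord d₁ d₂ → VertexSpace k d₁ d₂)
      (Y : ArrowCoord d₁ d₂ → RelCoord B d₁ d₂ →₀ k), homotopyMap X Y U V = LinearMap.id := by
  classical
  have hfin : Module.Finite k (ArrowSpace k d₁ d₂) :=
    Module.Finite.equiv (arrowCoordEquiv k d₁ d₂).symm
  obtain ⟨s, hs⟩ := (coboundary U V).rangeRestrict.exists_rightInverse_of_surjective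
    (LinearMap.range_rangeRestrict _)
  obtain ⟨X₀, hX₀⟩ := s.exists_extend
  have hX : ∀ C ∈ coboundaries U V, coboundary U V (X₀ C) = C := by
    intro C hC
    have h₁ : X₀ C = s ⟨C, hC⟩ := congrArg (fun f => f ⟨C, hC⟩) hX₀
    rw [h₁]
    exact congrArg Subtype.val (congrArg (fun f => f ⟨C, hC⟩) hs)
  let π : ArrowSpace k d₁ d₂ →ₗ[k] ArrowSpace k d₁ d₂ := LinearMap.id - coboundary U V ∘ₗ X₀
  let y : ArrowCoord d₁ d₂ → Module.Dual k (ArrowSpace k d₁ d₂) := fun e =>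
    LinearMap.proj e ∘ₗ (arrowCoordEquiv k d₁ d₂).toLinearMap ∘ₗ π
  have hy : ∀ e, ∃ c : RelCoord B d₁ d₂ →₀ k, (c.sum fun t a => a • relFun U V t) = y e := by
    intro e
    -- Double annihilator in finite dimension: a functional vanishing on the common kernel of the
    -- relation entries lies in their span.
    rw [← Finsupp.mem_span_range_iff_exists_finsupp,
      ← Subspace.dualCoannihilator_dualAnnihilator_eq
        (W := Submodule.span k (Set.range (relFun (B := B) U V))), Submodule.mem_dualAnnihilator]
    intro C hC
    rw [Submodule.mem_dualCoannihilator] at hC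
    have hC' : C ∈ coboundaries U V := by
      refine hcoc C fun ρ hρ x z => ?_
      ext i j
      exact hC _ (Submodule.subset_span ⟨⟨⟨ρ, hρ⟩, x, z, i, j⟩, rfl⟩)
    have : π C = 0 := by
      rw [LinearMap.sub_apply, LinearMap.comp_apply, hX C hC', LinearMap.id_apply, sub_self]
    change arrowCoordEquiv k d₁ d₂ (π C) e = 0
    rw [this, map_zero]
    rfl
  choose Y hY using hy
  let X : ArrowCoord d₁ d₂ → VertexSpace k d₁ d₂ := fun e =>
    X₀ ((arrowCoordEquiv k d₁ d₂).symm (Pi.single e 1))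
  refine ⟨X, Y, LinearMap.ext fun C => ?_⟩
  have hbase : baseChangeMap k X C = X₀ C := by
    have hC : C = ∑ e, arrowCoordEquiv k d₁ d₂ C e •
        (arrowCoordEquiv k d₁ d₂).symm (Pi.single e 1) := by
      apply (arrowCoordEquiv k d₁ d₂).injective
      rw [map_sum]
      simp only [map_smul, LinearEquiv.apply_symm_apply]
      exact pi_eq_sum_univ' _
    conv_rhs => rw [hC, map_sum]
    funext x
    simp only [baseChangeMap, LinearMap.coe_mk, AddHom.coe_mk, Finset.sum_apply, map_smul,
      Pi.smul_apply]
    refine Finset.sum_congr rfl fun e _ => ?_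
    congr 1
  rw [homotopyMap_apply, hbase, LinearMap.id_apply]
  have hYC : (fun e => (Y e).sum fun t c => algebraMap k k c * relFun U V t C) =
      arrowCoordEquiv k d₁ d₂ (C - coboundary U V (X₀ C)) := by
    funext e
    have h := congrArg (fun f : Module.Dual k (ArrowSpace k d₁ d₂) => f C) (hY e)
    refine Eq.trans ?_ h
    simp [Finsupp.sum]
  rw [hYC, LinearEquiv.symm_apply_apply]
  change coboundary U V (X₀ C) + _ = C
  abel

open Classical in
/-- If all cocycles are coboundaries at `(U, V)`, then the same holds for small cocycles near
`U ⊕ V`. -/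
theorem exists_poly_exists_cobd_eq {U : ArrowSpace k d₁ d₁} {V : ArrowSpace k d₂ d₂}
    (hcoc : ∀ C : ArrowSpace k d₁ d₂,
      (∀ ρ ∈ B.rels, ∀ x y, combDelta U C V x y (ρ x y) = 0) → C ∈ coboundaries U V) :
    ∃ t : Poly k (d₁ + d₂), evalAt (directSum U V) t = 1 ∧
      ∀ (R : Type u) [CommRing R] [Algebra k R] (I : Ideal R), I ^ 2 = ⊥ →
        ∀ M : ArrowSpace R (d₁ + d₂) (d₁ + d₂), IsUnit (evalAt M t) → B.IsRep M →
        (∀ a b α i j, block₂₁ M a b α i j ∈ I) →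
        ∃ h : VertexSpace R d₁ d₂, (∀ x i j, h x i j ∈ I) ∧
          cobd (block₁₁ M) (block₂₂ M) h = block₂₁ M := by
  obtain ⟨X, Y, hXY⟩ := exists_homotopyMap_eq_id hcoc
  let G := genericPoint k (d₁ + d₂)
  -- The determinant at the universal point. At `U ⊕ V` the operator is the identity, so `t` takes
  -- the value `1` there.
  let t : Poly k (d₁ + d₂) := (homotopyMatrix X Y (block₁₁ G) (block₂₂ G)).det
  have ht : ∀ (R : Type u) [CommRing R] [Algebra k R] (M : ArrowSpace R (d₁ + d₂) (d₁ + d₂)),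
      evalAt M t = (homotopyMatrix X Y (block₁₁ M) (block₂₂ M)).det := by
    intro R _ _ M
    have h := map_homotopyMatrix (evalAt (k := k) M) X Y (block₁₁ G) (block₂₂ G)
    have h₁ : (fun a b α => (block₁₁ G a b α).map (evalAt (k := k) M)) = block₁₁ M :=
      congrArg block₁₁ (map_genericPoint (k := k) M)
    have h₂ : (fun a b α => (block₂₂ G a b α).map (evalAt (k := k) M)) = block₂₂ M :=
      congrArg block₂₂ (map_genericPoint (k := k) M)
    rw [h₁, h₂] at h
    rw [← h]
    exact AlgHom.map_det _ _
  refine ⟨t, ?_, fun R _ _ I hI M hu hrep hM => ?_⟩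
  · rw [ht, directSum_eq_lowerTri, block₁₁_lowerTri, block₂₂_lowerTri, homotopyMatrix, hXY,
      LinearMap.id_comp, LinearEquiv.comp_symm, LinearMap.toMatrix'_id, Matrix.det_one]
  · rw [ht] at hu
    exact exists_cobd_eq hI hrep hM (homotopyMap_surjective hu)

end

/-! ### The unipotent subgroup `[1 0; h 1]` and lifting of group elements -/

section Unipotent

variable {Δ : Type v} [Quiver.{w} Δ] {R S : Type*} [CommRing R] [CommRing S] {d d₁ d₂ : Δ → ℕ}

lemma act_mul (g h : GLPoints R d) (M : ArrowSpace R d d) : act (g * h) M = act g (act h M) := by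
  funext a b α
  simp only [act, Pi.mul_apply, mul_inv_rev, Units.val_mul, Matrix.mul_assoc]

lemma act_one (M : ArrowSpace R d d) : act 1 M = M := by
  funext a b α
  simp [act]

/-- The matrices `[1, 0; h, 1]`. -/
def lowerMatrix {Δ : Type v} {d₁ d₂ : Δ → ℕ} (h : VertexSpace R d₁ d₂) (x : Δ) :
    Matrix (Fin ((d₁ + d₂) x)) (Fin ((d₁ + d₂) x)) R :=
  Matrix.reindex finSumFinEquiv finSumFinEquiv (Matrix.fromBlocks 1 0 (h x) 1)

lemma lowerMatrix_mul {Δ : Type v} {d₁ d₂ : Δ → ℕ} (h h' : VertexSpace R d₁ d₂) (x : Δ) :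
    lowerMatrix h x * lowerMatrix h' x = lowerMatrix (h + h') x := by
  refine (Matrix.submatrix_mul_equiv (Matrix.fromBlocks 1 0 (h x) 1)
    (Matrix.fromBlocks 1 0 (h' x) 1) _ finSumFinEquiv.symm _).trans ?_
  rw [Matrix.fromBlocks_multiply]
  simp [lowerMatrix]

lemma lowerMatrix_zero {Δ : Type v} {d₁ d₂ : Δ → ℕ} (x : Δ) :
    lowerMatrix (0 : VertexSpace R d₁ d₂) x = 1 := by
  change Matrix.submatrix (Matrix.fromBlocks 1 0 0 1) _ _ = _
  rw [Matrix.fromBlocks_one, Matrix.submatrix_one_equiv]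

/-- The element `[1, 0; h, 1]` of `GL_d`. -/
def lowerGL {Δ : Type v} {d₁ d₂ : Δ → ℕ} (h : VertexSpace R d₁ d₂) : GLPoints R (d₁ + d₂) :=
  fun x => ⟨lowerMatrix h x, lowerMatrix (-h) x,
    by rw [lowerMatrix_mul, add_neg_cancel, lowerMatrix_zero],
    by rw [lowerMatrix_mul, neg_add_cancel, lowerMatrix_zero]⟩

lemma block₂₁_act_lowerGL (h : VertexSpace R d₁ d₂) (M : ArrowSpace R (d₁ + d₂) (d₁ + d₂))
    (a b : Δ) (α : a ⟶ b) : block₂₁ (act (lowerGL h) M) a b α =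
      block₂₁ M a b α + cobd (block₁₁ M) (block₂₂ M) h a b α - h b * block₁₂ M a b α * h a := by
  change (lowerMatrix h b * M a b α * lowerMatrix (-h) a).submatrix (Fin.natAdd (d₁ b))
    (Fin.castAdd (d₂ a)) = _
  refine (submatrix_mul_fin (m := d₁ a) (n := d₂ a) _ _ _ _).trans ?_
  have e₁ : (lowerMatrix h b * M a b α).submatrix (Fin.natAdd (d₁ b)) (Fin.castAdd (d₂ a)) =
      h b * block₁₁ M a b α + block₂₁ M a b α := by
    refine (submatrix_mul_fin (m := d₁ b) (n := d₂ b) _ _ _ _).trans ?_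
    congr 1
    · congr 1
      ext i j
      simp [lowerMatrix]
    · refine Eq.trans ?_ (Matrix.one_mul _)
      congr 1
      ext i j
      simp [lowerMatrix]
  have e₂ : (lowerMatrix h b * M a b α).submatrix (Fin.natAdd (d₁ b)) (Fin.natAdd (d₁ a)) =
      h b * block₁₂ M a b α + block₂₂ M a b α := by
    refine (submatrix_mul_fin (m := d₁ b) (n := d₂ b) _ _ _ _).trans ?_
    congr 1
    · congr 1
      ext i j
      simp [lowerMatrix]
    · refine Eq.trans ?_ (Matrix.one_mul _)
      congr 1
      ext i j
      simp [lowerMatrix]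
  have e₃ : (lowerMatrix (-h) a).submatrix (Fin.castAdd (d₂ a)) (Fin.castAdd (d₂ a)) = 1 := by
    ext i j
    simp [lowerMatrix]
  have e₄ : (lowerMatrix (-h) a).submatrix (Fin.natAdd (d₁ a)) (Fin.castAdd (d₂ a)) = -h a := by
    ext i j
    simp [lowerMatrix]
  refine (congrArg₂ (· + ·) (congrArg₂ (· * ·) e₁ e₃) (congrArg₂ (· * ·) e₂ e₄)).trans ?_
  rw [cobd_apply, Matrix.mul_one, Matrix.mul_neg, Matrix.add_mul]
  abel

/-- The term `h M₁₂ h` is quadratic in `h` and dies. Thus a lower left block of the form `∂h` is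
removed by `lowerGL (-h)`. -/
lemma block₂₁_act_lowerGL_of_sq_zero {I : Ideal R} (hI : I ^ 2 = ⊥) {h : VertexSpace R d₁ d₂}
    (hh : ∀ x i j, h x i j ∈ I) (M : ArrowSpace R (d₁ + d₂) (d₁ + d₂)) :
    block₂₁ (act (lowerGL h) M) = block₂₁ M + cobd (block₁₁ M) (block₂₂ M) h := by
  funext a b α
  rw [block₂₁_act_lowerGL, Matrix.mul_assoc, mul_eq_zero_of_sq_zero hI (hh b), sub_zero]
  · rfl
  · rw [Matrix.map_mul]
    have : (h a).map (Ideal.Quotient.mk I) = 0 := by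
      ext i j
      exact Ideal.Quotient.eq_zero_iff_mem.2 (hh a i j)
    rw [this, Matrix.mul_zero]

lemma lowerGL_zero {Δ : Type v} {d₁ d₂ : Δ → ℕ} :
    lowerGL (0 : VertexSpace R d₁ d₂) = 1 :=
  funext fun x => Units.ext (lowerMatrix_zero x)

lemma map_lowerGL {Δ : Type v} {d₁ d₂ : Δ → ℕ} (φ : R →+* S) (h : VertexSpace R d₁ d₂) :
    (fun x => (lowerGL h x).map φ) = lowerGL (fun x => (h x).map φ) := by
  funext x
  apply Units.ext
  ext i j
  change φ (lowerMatrix h x i j) = lowerMatrix (fun x => (h x).map φ) x i j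
  obtain ⟨i, rfl⟩ := finSumFinEquiv.surjective i
  obtain ⟨j, rfl⟩ := finSumFinEquiv.surjective j
  rcases i with i | i <;> rcases j with j | j <;>
    simp [lowerMatrix, Matrix.one_apply, apply_ite φ]

/-- Points of `GL_d` lift along surjections with nilpotent kernel. -/
lemma exists_lift_GLPoints {Δ : Type v} {d : Δ → ℕ} {I : Ideal R} (hI : IsNilpotent I)
    (g : GLPoints (R ⧸ I) d) :
    ∃ g' : GLPoints R d, (fun x => (g' x).map (Ideal.Quotient.mk I)) = g := by
  have H : ∀ x, ∃ g' : Matrix.GeneralLinearGroup (Fin (d x)) R,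
      g'.map (Ideal.Quotient.mk I) = g x := by
    intro x
    choose m hm using fun i j => Ideal.Quotient.mk_surjective ((g x).val i j)
    have hmap : (Matrix.of m).map (Ideal.Quotient.mk I) = (g x).val := by
      ext i j
      exact hm i j
    -- Any entrywise lift is invertible, since its determinant is a unit modulo a nilpotent ideal.
    have hdet : IsUnit (Matrix.of m).det := by
      rw [← IsNilpotent.isUnit_quotient_mk_iff hI, RingHom.map_det]
      change IsUnit ((Matrix.of m).map (Ideal.Quotient.mk I)).det
      rw [hmap]
      exact (Matrix.isUnit_iff_isUnit_det _).1 (g x).isUnit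
    exact ⟨Matrix.GeneralLinearGroup.mk'' _ hdet, Units.ext hmap⟩
  choose g' hg' using H
  exact ⟨g', funext hg'⟩

end Unipotent

/-! ### Functors of points of the affine space, of `GL_d` and of the product -/

section Affine

variable {k : Type u} {Δ : Type v} [Field k] [Quiver.{w} Δ] {d : Δ → ℕ} {R : Type*} [CommRing R]
  [Algebra k R]

lemma evalAt_map_genericPoint (χ : Poly k d →ₐ[k] R) (f : Poly k d) :
    evalAt (fun a b α => (genericPoint k d a b α).map χ) f = χ f := by
  have hid : evalAt (k := k) (genericPoint k d) = AlgHom.id k (Poly k d) := by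
    refine MvPolynomial.algHom_ext fun c => ?_
    simp [evalAt, coords, genericPoint]
  rw [← map_evalAt, hid]
  rfl

lemma eq_of_evalAt_eq {M M' : ArrowSpace R d d}
    (h : ∀ f : Poly k d, evalAt M f = evalAt M' f) : M = M' := by
  funext a b α
  ext i j
  simpa [evalAt, coords] using h (MvPolynomial.X ⟨a, b, α, i, j⟩)

end Affine

section Points

variable {k : Type u} {Δ : Type v} [Field k] [Fintype Δ] {d : Δ → ℕ} {R S : Type*} [CommRing R]
  [Algebra k R] [CommRing S] [Algebra k S]

/-- Evaluation of functions on `GL_d` at an `R`-point. -/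
def evalGLPoint (g : GLPoints R d) : GLRing k d →ₐ[k] R :=
  IsLocalization.liftAlgHom (M := Submonoid.powers (∏ x, (genericMatrix k d x).det))
    (f := MvPolynomial.aeval (R := k) fun c : Σ x : Δ, Fin (d x) × Fin (d x) =>
      (g c.1).val c.2.1 c.2.2)
    (by
      rintro ⟨y, n, rfl⟩
      simp only [map_pow, map_prod]
      refine (IsUnit.prod_univ_iff.2 fun x => ?_).pow n
      have h := (Matrix.isUnit_iff_isUnit_det _).1 (g x).isUnit
      rw [AlgHom.map_det]
      convert! h using 2
      ext i j
      simp [genericMatrix])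

lemma evalGLPoint_algebraMap (g : GLPoints R d) (p : GLPoly k d) :
    evalGLPoint g (algebraMap (GLPoly k d) (GLRing k d) p) =
      MvPolynomial.aeval (R := k) (fun c : Σ x : Δ, Fin (d x) × Fin (d x) =>
        (g c.1).val c.2.1 c.2.2) p := by
  simp [evalGLPoint]

lemma map_evalGLPoint_genericGL (g : GLPoints R d) (x : Δ) :
    (genericGL k d x).map (evalGLPoint g : GLRing k d →ₐ[k] R).toRingHom = g x := by
  ext i j
  change evalGLPoint g (algebraMap (GLPoly k d) (GLRing k d) _) = _
  rw [evalGLPoint_algebraMap]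
  simp [genericMatrix]

lemma GLRing.algHom_ext {φ ψ : GLRing k d →ₐ[k] R}
    (h : ∀ x, (genericGL k d x).map φ.toRingHom = (genericGL k d x).map ψ.toRingHom) : φ = ψ := by
  refine IsLocalization.algHom_ext (Submonoid.powers (∏ x, (genericMatrix k d x).det)) ?_
  refine MvPolynomial.algHom_ext fun c => ?_
  have := congrArg (fun g => g.val c.2.1 c.2.2) (h c.1)
  have hX : (genericGL k d c.1).val c.2.1 c.2.2 =
      algebraMap (GLPoly k d) (GLRing k d) (MvPolynomial.X c) := by
    change algebraMap (GLPoly k d) (GLRing k d) _ = _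
    simp [genericMatrix]
  change φ ((genericGL k d c.1).val c.2.1 c.2.2) = ψ ((genericGL k d c.1).val c.2.1 c.2.2) at this
  rw [hX] at this
  exact this

variable [Quiver.{w} Δ] {J : Ideal (Poly k d)}

/-- The `GL_d`-component of an `R`-point of `GL_d × Spec (k[𝔸^{d,d}] / J)`. -/
def pointGL (φ : ProdRing J →ₐ[k] R) : GLPoints R d :=
  fun x => (genericGL k d x).map
    (φ.comp (Algebra.TensorProduct.includeLeft : GLRing k d →ₐ[k] ProdRing J)).toRingHom

/-- The function on `Spec (k[𝔸^{d,d}] / J)` given by a polynomial, on the product. -/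
def includePoly (J : Ideal (Poly k d)) : Poly k d →ₐ[k] ProdRing J :=
  (Algebra.TensorProduct.includeRight : Poly k d ⧸ J →ₐ[k] ProdRing J).comp (Ideal.Quotient.mkₐ k J)

/-- The second component of an `R`-point of `GL_d × Spec (k[𝔸^{d,d}] / J)`. -/
def pointRep (φ : ProdRing J →ₐ[k] R) : ArrowSpace R d d :=
  fun a b α => (genericPoint k d a b α).map (φ.comp (includePoly J))

lemma evalAt_pointRep (φ : ProdRing J →ₐ[k] R) (f : Poly k d) :
    evalAt (pointRep φ) f = φ (includePoly J f) :=
  evalAt_map_genericPoint _ f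

lemma evalAt_pointRep_eq_zero (φ : ProdRing J →ₐ[k] R) (f : Poly k d) (hf : f ∈ J) :
    evalAt (pointRep φ) f = 0 := by
  rw [evalAt_pointRep]
  change φ (1 ⊗ₜ Ideal.Quotient.mk J f) = 0
  rw [Ideal.Quotient.eq_zero_iff_mem.2 hf, TensorProduct.tmul_zero, map_zero]

/-- Translates the homomorphism of coordinate rings into the action on `R`-points. -/
lemma map_actionToAffine (φ : ProdRing J →ₐ[k] R) (f : Poly k d) :
    φ (actionToAffine J f) = evalAt (act (pointGL φ) (pointRep φ)) f := by
  let G : GLPoints (ProdRing J) d := fun x => (genericGL k d x).map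
    (Algebra.TensorProduct.includeLeft : GLRing k d →ₐ[k] ProdRing J).toRingHom
  let M : ArrowSpace (ProdRing J) d d := fun a b α => (genericPoint k d a b α).map (includePoly J)
  have h₁ := map_evalAt (R := ProdRing J) φ (act G M) f
  have h₂ := map_act (R := ProdRing J) φ G M
  exact h₁.trans (congrArg (fun M : ArrowSpace R d d => evalAt (k := k) M f) h₂)

/-- The `R`-point of `GL_d × Spec (k[𝔸^{d,d}] / J)` with given components. -/
def prodPoint (g : GLPoints R d) (M : ArrowSpace R d d) (hM : ∀ f ∈ J, evalAt M f = 0) :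
    ProdRing J →ₐ[k] R :=
  Algebra.TensorProduct.productMap (evalGLPoint g) (Ideal.Quotient.liftₐ J (evalAt M) hM)

lemma pointGL_prodPoint (g : GLPoints R d) (M : ArrowSpace R d d) (hM : ∀ f ∈ J, evalAt M f = 0) :
    pointGL (prodPoint g M hM) = g := by
  funext x
  have : (prodPoint g M hM).comp (Algebra.TensorProduct.includeLeft : GLRing k d →ₐ[k] ProdRing J) =
      evalGLPoint g := Algebra.TensorProduct.productMap_left _ _
  rw [pointGL, this, map_evalGLPoint_genericGL]

lemma pointRep_prodPoint (g : GLPoints R d) (M : ArrowSpace R d d)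
    (hM : ∀ f ∈ J, evalAt M f = 0) : pointRep (prodPoint g M hM) = M := by
  have : (prodPoint g M hM).comp (includePoly J) = evalAt M := by
    rw [includePoly, ← AlgHom.comp_assoc, prodPoint, Algebra.TensorProduct.productMap_right]
    rfl
  unfold pointRep
  rw [this]
  exact map_genericPoint M

/-- Together with `prodPoint`, this identifies homomorphisms out of the coordinate ring with pairs
`(g, M)`. -/
lemma ProdRing.algHom_ext {φ ψ : ProdRing J →ₐ[k] R} (h₁ : pointGL φ = pointGL ψ)
    (h₂ : pointRep φ = pointRep ψ) : φ = ψ := by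
  refine Algebra.TensorProduct.ext' fun c f => ?_
  have e₁ := GLRing.algHom_ext fun x => congrFun h₁ x
  obtain ⟨f, rfl⟩ := Ideal.Quotient.mk_surjective f
  have e₂ : φ (includePoly J f) = ψ (includePoly J f) := by
    rw [← evalAt_pointRep, ← evalAt_pointRep, h₂]
  have hcf : c ⊗ₜ[k] (Ideal.Quotient.mk J f) = ((c ⊗ₜ 1 : ProdRing J) * includePoly J f) := by
    change _ = (c ⊗ₜ 1 : ProdRing J) * (1 ⊗ₜ Ideal.Quotient.mk J f)
    rw [Algebra.TensorProduct.tmul_mul_tmul, mul_one, one_mul]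
  rw [hcf, map_mul, map_mul, e₂]
  exact congrArg (· * _) (congrArg (fun χ : GLRing k d →ₐ[k] R => χ c) e₁)

/-- An invariant set of `k`-points with its reduced structure is an invariant subscheme. -/
lemma evalAt_act_eq_zero [Infinite k] {Z : Set (ArrowSpace k d d)} (hZ : IsInvariant Z)
    (g : GLPoints R d) {M : ArrowSpace R d d} (hM : ∀ f ∈ idealOf Z, evalAt M f = 0) :
    ∀ f ∈ idealOf Z, evalAt (act g M) f = 0 := by
  intro f hf
  -- The universal case `J = idealOf Z` is specialized to the point `(g, M)`.
  have h := map_actionToAffine (prodPoint g M hM) f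
  rw [pointGL_prodPoint, pointRep_prodPoint] at h
  rw [← h, actionToAffine_eq_zero hZ le_rfl f hf, map_zero]

end Points

/-! ### Finite presentation of the action map and reducedness of the intersection -/

section Finiteness

variable {k : Type u} {Δ : Type v} [Field k] [Quiver.{w} Δ] [Fintype Δ]
  [∀ a b : Δ, Finite (a ⟶ b)] {d : Δ → ℕ}

/-- Both rings are of finite type over `k`, and over the noetherian source finite type is finite
presentation. -/
lemma finitePresentation_actionMap [Infinite k] {Z : Set (ArrowSpace k d d)}
    (hZ : IsInvariant Z) {J : Ideal (Poly k d)} (hJ : idealOf Z ≤ J) :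
    RingHom.FinitePresentation (A := Poly k d ⧸ idealOf Z) (B := ProdRing J)
      (actionMap hZ hJ).toRingHom := by
  have : Algebra.FiniteType (GLPoly k d) (GLRing k d) :=
    IsLocalization.finiteType_of_monoid_fg
      (Submonoid.powers (∏ x, (genericMatrix k d x).det)) (GLRing k d)
  have : Algebra.FiniteType k (GLRing k d) := Algebra.FiniteType.trans (S := GLPoly k d) inferInstance
    inferInstance
  have : Algebra.FiniteType k (ProdRing J) := Algebra.FiniteType.trans (S := GLRing k d)
    inferInstance inferInstance
  refine RingHom.FinitePresentation.of_finiteType.1 ?_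
  refine RingHom.FiniteType.of_comp_finiteType (f := algebraMap k (Poly k d ⧸ idealOf Z)) ?_
  have h : (actionMap hZ hJ).toRingHom.comp (algebraMap k (Poly k d ⧸ idealOf Z)) =
      algebraMap k (ProdRing J) := (actionMap hZ hJ).comp_algebraMap
  rw [h]
  exact RingHom.finiteType_algebraMap.2 inferInstance

end Finiteness

section Reduced

variable {k : Type u} {Δ : Type v} [Field k] [Quiver.{w} Δ] {d : Δ → ℕ}

lemma isReduced_quotient_idealOf (Z : Set (ArrowSpace k d d)) :
    IsReduced (Poly k d ⧸ idealOf Z) := by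
  rw [← Ideal.isRadical_iff_quotient_reduced]
  rintro f ⟨n, hn⟩
  rw [mem_idealOf] at hn ⊢
  intro M hM
  have := hn M hM
  rw [map_pow] at this
  exact eq_zero_of_pow_eq_zero this

/-- If the action map is smooth at `(1, N)`, then the scheme acted on is reduced at `N`. -/
lemma isReduced_localization_of_smoothAt [Fintype Δ] [Infinite k] {Z : Set (ArrowSpace k d d)}
    (hZ : IsInvariant Z) {J : Ideal (Poly k d)} (hJ : idealOf Z ≤ J) {N : ArrowSpace k d d}
    (hN : ∀ f ∈ J, evalAt N f = 0)
    (hs : SmoothAt (B := ProdRing J) (actionMap hZ hJ).toRingHom (prodPointIdeal 1 N hN)) :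
    IsReduced (Localization.AtPrime (pointIdeal N hN)) := by
  have hred := isReduced_quotient_idealOf Z
  obtain ⟨f, hf, hredf⟩ := hs.exists_isReduced
  -- Restriction along `M ↦ (1, M)`, a section of the second projection; it carries `N` to `(1, N)`.
  let ev : ProdRing J →ₐ[k] Poly k d ⧸ J := Algebra.TensorProduct.productMap
    ((Algebra.ofId k (Poly k d ⧸ J)).comp (evalGL 1)) (AlgHom.id k (Poly k d ⧸ J))
  have hevN : (evalQuot N hN).comp ev =
      Algebra.TensorProduct.productMap (evalGL 1) (evalQuot N hN) := by
    refine Algebra.TensorProduct.ext' fun a b => ?_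
    simp [ev, Algebra.ofId_apply]
  refine isReduced_localization_of_retract (D := ProdRing J)
    (Algebra.TensorProduct.includeRight : Poly k d ⧸ J →ₐ[k] ProdRing J).toRingHom ev.toRingHom
    (fun y => ?_) (pointIdeal N hN) f fun h => hf ?_
  · change ev (1 ⊗ₜ y) = y
    simp [ev]
  · change Algebra.TensorProduct.productMap (evalGL 1) (evalQuot N hN) f = 0
    rw [← hevN]
    exact h

end Reduced

/-! ### Smoothness of the action map -/

section Inter

variable {k : Type u} {Δ : Type u} [Field k] [Quiver.{u} Δ] [Fintype Δ] {B : BoundQuiver k Δ}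
  {d₁ d₂ : Δ → ℕ} {Z : Set (ArrowSpace k (d₁ + d₂) (d₁ + d₂))}

/-- All equations of `mod_Λ` vanish on the set `Z`, hence lie in its vanishing ideal. So the only
further condition for a point of `Z` to lie in the intersection is block triangularity. -/
lemma isRep_of_idealOf (hZrep : ∀ M ∈ Z, B.IsRep M) {R : Type*} [CommRing R] [Algebra k R]
    {M : ArrowSpace R (d₁ + d₂) (d₁ + d₂)} (hM : ∀ f ∈ idealOf Z, evalAt M f = 0) :
    B.IsRep M := by
  rw [← B.modIdeal_le_ker_iff (k := k)]
  refine le_trans (fun f hf => ?_) (show idealOf Z ≤ RingHom.ker (evalAt (k := k) M) from hM)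
  rw [mem_idealOf]
  intro M' hM'
  exact (B.modIdeal_le_ker_iff M').2 (hZrep M' hM') hf

lemma interIdeal_eval_iff (hZrep : ∀ M ∈ Z, B.IsRep M) {R : Type*} [CommRing R] [Algebra k R]
    (M : ArrowSpace R (d₁ + d₂) (d₁ + d₂)) :
    (∀ f ∈ B.interIdeal Z, evalAt M f = 0) ↔
      (∀ f ∈ idealOf Z, evalAt M f = 0) ∧ IsUpper M := by
  change B.interIdeal Z ≤ RingHom.ker (evalAt (k := k) M) ↔ _
  rw [BoundQuiver.interIdeal, sup_le_iff, B.upperIdeal_le_ker_iff]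
  exact ⟨fun h => ⟨h.1, h.2.2⟩, fun h => ⟨h.1, isRep_of_idealOf hZrep h.1, h.2⟩⟩

variable [∀ a b : Δ, Finite (a ⟶ b)]

/-- In a lifting problem a point `P` of `Z` over `R` is given, together with a factorization `g * M`
of its reduction over `R ⧸ I` with `M` in the intersection. The factorization has to be lifted to
`R`. -/
theorem smoothAt_actionMap [Infinite k] {U : ArrowSpace k d₁ d₁} {V : ArrowSpace k d₂ d₂}
    (hcoc : ∀ C : ArrowSpace k d₁ d₂,
      (∀ ρ ∈ B.rels, ∀ x y, combDelta U C V x y (ρ x y) = 0) → C ∈ coboundaries U V)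
    (hZrep : ∀ M ∈ Z, B.IsRep M) (hZ : IsInvariant Z)
    (hN : ∀ f ∈ B.interIdeal Z, evalAt (directSum U V) f = 0) :
    SmoothAt (B := ProdRing (B.interIdeal Z))
      (actionMap hZ (B.idealOf_le_interIdeal Z)).toRingHom
      (prodPointIdeal 1 (directSum U V) hN) := by
  let _ : ∀ a b : Δ, Fintype (a ⟶ b) := fun a b => Fintype.ofFinite _
  have hprime : (prodPointIdeal 1 (directSum U V) hN).IsPrime := RingHom.ker_isPrime _
  obtain ⟨t, ht, H⟩ := exists_poly_exists_cobd_eq hcoc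
  refine smoothAt_of_lifting _ (finitePresentation_actionMap hZ _) _
    fun R _ I hI a b hb hab => ?_
  -- The test ring carries no `k`-structure of its own; it gets one through `a`, and the
  -- compatibility `hab` makes `b` linear as well.
  let _ : Algebra k R := (a.comp (algebraMap k (Poly k (d₁ + d₂) ⧸ idealOf Z))).toAlgebra
  let a' : Poly k (d₁ + d₂) ⧸ idealOf Z →ₐ[k] R := { a with commutes' := fun _ => rfl }
  let b' : ProdRing (B.interIdeal Z) →ₐ[k] R ⧸ I :=
    { b with
      commutes' := fun c => by
        have h := congrArg (fun f => f (algebraMap k (Poly k (d₁ + d₂) ⧸ idealOf Z) c)) hab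
        refine Eq.trans (congrArg b ?_) h.symm
        exact ((actionMap hZ (B.idealOf_le_interIdeal Z)).commutes c).symm }
  let π : R →ₐ[k] R ⧸ I := Ideal.Quotient.mkₐ k I
  let P : ArrowSpace R (d₁ + d₂) (d₁ + d₂) := fun x y α => (genericPoint k (d₁ + d₂) x y α).map
    (a'.comp (Ideal.Quotient.mkₐ k (idealOf Z)))
  have hPa : ∀ f, evalAt P f = a (Ideal.Quotient.mk (idealOf Z) f) := fun f =>
    evalAt_map_genericPoint _ f
  have hP : ∀ f ∈ idealOf Z, evalAt P f = 0 := fun f hf => by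
    rw [hPa, Ideal.Quotient.eq_zero_iff_mem.2 hf, map_zero]
  have hact : act (pointGL b') (pointRep b') = fun x y α => (P x y α).map π := by
    refine eq_of_evalAt_eq (k := k) fun f => ?_
    rw [← map_actionToAffine, ← map_evalAt, hPa]
    exact (congrArg (fun g => g (Ideal.Quotient.mk (idealOf Z) f)) hab).symm
  obtain ⟨g₀, hg₀⟩ := exists_lift_GLPoints ⟨2, hI⟩ (pointGL b')
  have hg₀inv : (fun x => ((g₀⁻¹) x).map π.toRingHom) = (pointGL b')⁻¹ := by
    rw [← hg₀]
    funext x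
    exact map_inv (Matrix.GeneralLinearGroup.map π.toRingHom) (g₀ x)
  let P' := act g₀⁻¹ P
  have hP'π : (fun x y α => (P' x y α).map π) = pointRep b' := by
    refine (map_act π g₀⁻¹ P).trans ?_
    rw [hg₀inv, ← hact, ← act_mul, inv_mul_cancel, act_one]
  have hP' : ∀ f ∈ idealOf Z, evalAt P' f = 0 := evalAt_act_eq_zero hZ _ hP
  -- `P'` lifts the block triangular `pointRep b'`, so its lower left block vanishes modulo `I`.
  have hsmall : ∀ x y α i j, block₂₁ P' x y α i j ∈ I := by
    have hu := ((interIdeal_eval_iff hZrep (pointRep b')).1 (evalAt_pointRep_eq_zero b')).2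
    rw [← hP'π] at hu
    exact fun x y α i j => Ideal.Quotient.eq_zero_iff_mem.1 (hu x y α i j)
  -- As `t` is `1` at `U ⊕ V`, it lies outside the prime of `(1, N)`; so `b` sends it to a unit, and
  -- units lift modulo `I`.
  have hunit : IsUnit (evalAt P' t) := by
    rw [← IsNilpotent.isUnit_quotient_mk_iff (I := I) ⟨2, hI⟩]
    have h₁ : Ideal.Quotient.mk I (evalAt P' t) = b (includePoly (B.interIdeal Z) t) := by
      refine (map_evalAt π P' t).trans ?_
      rw [hP'π, evalAt_pointRep]
      rfl
    rw [h₁]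
    refine hb _ fun h => ?_
    have h₂ : evalAt (directSum U V) t = 0 := by
      have h₃ : Algebra.TensorProduct.productMap (evalGL 1) (evalQuot (directSum U V) hN)
        (includePoly (B.interIdeal Z) t) = 0 := h
      rw [← h₃]
      change _ = Algebra.TensorProduct.productMap (evalGL 1) (evalQuot (directSum U V) hN)
        (1 ⊗ₜ Ideal.Quotient.mk _ t)
      rw [Algebra.TensorProduct.productMap_apply_tmul, map_one, one_mul]
      rfl
    rw [ht] at h₂
    exact one_ne_zero h₂
  obtain ⟨h, hh, hcob⟩ := H R I hI P' hunit (isRep_of_idealOf hZrep hP') hsmall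
  have hh' : ∀ x i j, (-h) x i j ∈ I := fun x i j => I.neg_mem (hh x i j)
  let g₁ := lowerGL (-h)
  have hg₁ : (fun x => (g₁ x).map (Ideal.Quotient.mk I)) = 1 := by
    rw [map_lowerGL, ← lowerGL_zero]
    congr 1
    funext x
    ext i j
    exact Ideal.Quotient.eq_zero_iff_mem.2 (hh' x i j)
  let M := act g₁ P'
  have hM : ∀ f ∈ B.interIdeal Z, evalAt M f = 0 := by
    refine (interIdeal_eval_iff hZrep M).2 ⟨evalAt_act_eq_zero hZ _ hP', ?_⟩
    rw [isUpper_iff_block₂₁, block₂₁_act_lowerGL_of_sq_zero hI hh', map_neg, hcob, add_neg_cancel]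
  -- The correction `g₁` is trivial modulo `I`, so `(g, M)` still lifts the given pair, while `g * M
  -- = P` holds over `R`.
  let g := g₀ * g₁⁻¹
  have hgM : act g M = P := by
    rw [← act_mul, inv_mul_cancel_right, ← act_mul, mul_inv_cancel, act_one]
  let c := prodPoint g M hM
  refine ⟨c.toRingHom, ?_, ?_⟩
  · refine Ideal.Quotient.ringHom_ext (RingHom.ext fun f => ?_)
    change c (actionToAffine (B.interIdeal Z) f) = a (Ideal.Quotient.mk (idealOf Z) f)
    rw [map_actionToAffine, pointGL_prodPoint, pointRep_prodPoint, hgM, hPa]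
  · have hcb : π.comp c = b' := by
      apply ProdRing.algHom_ext
      · have h₁ : pointGL (π.comp c) = fun x => (pointGL c x).map π.toRingHom := rfl
        rw [h₁, pointGL_prodPoint, ← hg₀]
        funext x
        have h₂ := congrFun hg₁ x
        change Matrix.GeneralLinearGroup.map (Ideal.Quotient.mk I) (g₀ x * (g₁ x)⁻¹) = _
        rw [map_mul, map_inv]
        change _ * ((g₁ x).map (Ideal.Quotient.mk I))⁻¹ = _
        rw [h₂, Pi.one_apply, inv_one, mul_one]
      · have h₁ : pointRep (π.comp c) = fun x y α => (pointRep c x y α).map π := rfl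
        rw [h₁, pointRep_prodPoint, ← hP'π]
        refine (map_act π g₁ P').trans ?_
        have h₂ : (fun x => (g₁ x).map π.toRingHom) = 1 := hg₁
        rw [h₂, act_one]
    exact congrArg AlgHom.toRingHom hcb

end Inter

/-! ### Tangent spaces via dual numbers -/

section Tangent

variable {k : Type u} {Δ : Type u} [Field k] [Quiver.{u} Δ] {d d₁ d₂ : Δ → ℕ}

/-- The lower left block as a linear map. -/
def block₂₁Linear (k : Type u) [Field k] (d₁ d₂ : Δ → ℕ) :
    ArrowSpace k (d₁ + d₂) (d₁ + d₂) →ₗ[k] ArrowSpace k d₁ d₂ where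
  toFun := block₂₁
  map_add' _ _ := rfl
  map_smul' _ _ := rfl

lemma isUpper_dualPoint_iff {N W : ArrowSpace k (d₁ + d₂) (d₁ + d₂)} (hN : IsUpper N) :
    IsUpper (dualPoint N W) ↔ block₂₁ W = 0 := by
  rw [← isUpper_iff_block₂₁]
  refine forall₅_congr fun a b α i j => ?_
  change TrivSqZeroExt.inl (N a b α _ _) + TrivSqZeroExt.inr (W a b α _ _) = (0 : DualNumber k) ↔ _
  rw [hN a b α i j, TrivSqZeroExt.inl_zero, zero_add, ← TrivSqZeroExt.inr_zero k]
  exact TrivSqZeroExt.inr_injective.eq_iff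

lemma block₂₁_dualPoint_zero {N : ArrowSpace k (d₁ + d₂) (d₁ + d₂)} (hN : IsUpper N) :
    block₂₁ (dualPoint N 0) = 0 := by
  have h : block₂₁ (0 : ArrowSpace k (d₁ + d₂) (d₁ + d₂)) = 0 := rfl
  rw [← isUpper_iff_block₂₁, isUpper_dualPoint_iff hN, h]

lemma dualPoint_eq {N : ArrowSpace k d d} {M : ArrowSpace (DualNumber k) d d}
    (hM : (fun a b α => (M a b α).map TrivSqZeroExt.fst) = N) :
    dualPoint N (fun a b α => (M a b α).map TrivSqZeroExt.snd) = M := by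
  subst hM
  funext a b α
  ext i j
  · simp [dualPoint]
  · simp [dualPoint]

/-- The ideal generated by `ε`. -/
def epsIdeal (k : Type u) [Field k] : Ideal (DualNumber k) :=
  RingHom.ker (TrivSqZeroExt.fstHom k k k)

lemma mem_epsIdeal {z : DualNumber k} : z ∈ epsIdeal k ↔ z.fst = 0 := Iff.rfl

lemma epsIdeal_sq : epsIdeal k ^ 2 = ⊥ := by
  rw [sq, eq_bot_iff, Ideal.mul_le]
  intro r hr s hs
  rw [mem_epsIdeal] at hr hs
  rw [Ideal.mem_bot]
  ext <;> simp [hr, hs]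

variable {U : ArrowSpace k d₁ d₁} {V : ArrowSpace k d₂ d₂}

/-- As `h` is a multiple of `ε`, only the constant terms of `A` and `D` contribute. -/
lemma snd_cobd {A : ArrowSpace (DualNumber k) d₁ d₁} {D : ArrowSpace (DualNumber k) d₂ d₂}
    (hA : ∀ a b α i j, (A a b α i j).fst = U a b α i j)
    (hD : ∀ a b α i j, (D a b α i j).fst = V a b α i j)
    {h : VertexSpace (DualNumber k) d₁ d₂} (hh : ∀ x i j, h x i j ∈ epsIdeal k) (a b : Δ)
    (α : a ⟶ b) : (cobd A D h a b α).map TrivSqZeroExt.snd =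
      coboundary U V (fun x => (h x).map TrivSqZeroExt.snd) a b α := by
  have hh' : ∀ x i j, (h x i j).fst = 0 := hh
  ext i j
  change _ = (_ - _ : Matrix _ _ k) i j
  simp [cobd_apply, Matrix.mul_apply, TrivSqZeroExt.snd_sum, hA, hD, hh', mul_comm]

variable [Fintype Δ] {B : BoundQuiver k Δ}
  {Z : Set (ArrowSpace k (d₁ + d₂) (d₁ + d₂))}

/-- Moving the constant point `N` by `[1 0; εh 1]` gives a tangent vector to the invariant scheme
`Z` whose lower left block is `hU - Vh`. -/
lemma coboundaries_le_map_tangentSpace [Infinite k] (hZ : IsInvariant Z)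
    (hN : directSum U V ∈ Z) :
    coboundaries U V ≤ (tangentSpace (idealOf Z) (directSum U V)).map (block₂₁Linear k d₁ d₂) := by
  rintro _ ⟨h, rfl⟩
  set N := directSum U V
  have hN0 : ∀ f ∈ idealOf Z, evalAt N f = 0 := fun f hf => mem_idealOf.1 hf N hN
  have hNu : IsUpper N := isUpper_directSum U V
  let h' : VertexSpace (DualNumber k) d₁ d₂ := fun x => (h x).map TrivSqZeroExt.inr
  have hh' : ∀ x i j, h' x i j ∈ epsIdeal k := fun x i j => by simp [mem_epsIdeal, h']
  let M := act (lowerGL h') (dualPoint N 0)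
  have hM : ∀ f ∈ idealOf Z, evalAt M f = 0 :=
    evalAt_act_eq_zero hZ _ ((mem_tangentSpace_iff hN0 0).1 (Submodule.zero_mem _))
  have hfst : (fun a b α => (M a b α).map TrivSqZeroExt.fst) = N := by
    have h₁ := map_act (TrivSqZeroExt.fstHom k k k) (lowerGL h') (dualPoint N 0)
    have h₂ : (fun x => (lowerGL h' x).map (TrivSqZeroExt.fstHom k k k).toRingHom) = 1 := by
      rw [map_lowerGL, ← lowerGL_zero]
      congr 1
    have h₃ : (fun a b α => (dualPoint N 0 a b α).map (TrivSqZeroExt.fstHom k k k)) = N := by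
      funext a b α
      ext i j
      simp [dualPoint]
    rw [h₂, h₃, act_one] at h₁
    exact h₁
  refine ⟨fun a b α => (M a b α).map TrivSqZeroExt.snd, ?_, ?_⟩
  · rw [SetLike.mem_coe, mem_tangentSpace_iff hN0, dualPoint_eq hfst]
    exact hM
  · funext a b α
    change (block₂₁ M a b α).map TrivSqZeroExt.snd = _
    have hA : ∀ a b α i j, (block₁₁ (dualPoint N 0) a b α i j).fst = U a b α i j :=
      fun a b α i j => by simp [block₁₁, dualPoint, N, directSum]
    have hD : ∀ a b α i j, (block₂₂ (dualPoint N 0) a b α i j).fst = V a b α i j :=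
      fun a b α i j => by simp [block₂₂, dualPoint, N, directSum]
    have hM₂₁ : block₂₁ M = cobd (block₁₁ (dualPoint N 0)) (block₂₂ (dualPoint N 0)) h' :=
      (block₂₁_act_lowerGL_of_sq_zero (R := DualNumber k) (I := epsIdeal k) epsIdeal_sq hh'
        (dualPoint N 0)).trans
        (by rw [block₂₁_dualPoint_zero hNu, zero_add])
    rw [hM₂₁, snd_cobd hA hD hh']
    rfl

/-- The tangent space of the intersection consists of the block upper triangular tangent vectors. -/
lemma mem_tangentSpace_interIdeal_iff (hZrep : ∀ M ∈ Z, B.IsRep M)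
    {N : ArrowSpace k (d₁ + d₂) (d₁ + d₂)} (hN : N ∈ Z) (hu : IsUpper N)
    (W : ArrowSpace k (d₁ + d₂) (d₁ + d₂)) :
    W ∈ tangentSpace (B.interIdeal Z) N ↔ W ∈ tangentSpace (idealOf Z) N ∧ block₂₁ W = 0 := by
  rw [mem_tangentSpace_iff (B.interIdeal_eval hZrep hN hu),
    mem_tangentSpace_iff fun f hf => mem_idealOf.1 hf N hN, interIdeal_eval_iff hZrep,
    isUpper_dualPoint_iff hu]

variable [∀ a b : Δ, Finite (a ⟶ b)]

/-- The square-zero statement is applied over the dual numbers to `N + εW`: its lower left block is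
a multiple of `ε`, and `t` is a unit there because its constant term is `t(N) = 1`. -/
lemma map_tangentSpace_le_coboundaries
    (hcoc : ∀ C : ArrowSpace k d₁ d₂,
      (∀ ρ ∈ B.rels, ∀ x y, combDelta U C V x y (ρ x y) = 0) → C ∈ coboundaries U V)
    (hZrep : ∀ M ∈ Z, B.IsRep M) (hN : directSum U V ∈ Z) :
    (tangentSpace (idealOf Z) (directSum U V)).map (block₂₁Linear k d₁ d₂) ≤ coboundaries U V := by
  let _ : ∀ a b : Δ, Fintype (a ⟶ b) := fun a b => Fintype.ofFinite _
  rintro _ ⟨W, hW, rfl⟩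
  obtain ⟨t, ht, H⟩ := exists_poly_exists_cobd_eq hcoc
  set N := directSum U V
  have hN0 : ∀ f ∈ idealOf Z, evalAt N f = 0 := fun f hf => mem_idealOf.1 hf N hN
  rw [SetLike.mem_coe, mem_tangentSpace_iff hN0] at hW
  obtain ⟨h, hh, he⟩ := H (DualNumber k) (epsIdeal k) epsIdeal_sq (dualPoint N W)
    (by rw [TrivSqZeroExt.isUnit_iff_isUnit_fst, fst_evalAt_dualPoint, ht]; exact isUnit_one)
    (isRep_of_idealOf hZrep hW) (fun a b α i j => by
      simp [mem_epsIdeal, block₂₁, dualPoint, N, directSum])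
  refine ⟨fun x => (h x).map TrivSqZeroExt.snd, ?_⟩
  funext a b α
  rw [← snd_cobd (U := U) (V := V) (fun a b α i j => ?_) (fun a b α i j => ?_) hh, he]
  · ext i j
    simp [block₂₁, dualPoint]
    rfl
  · simp [block₁₁, dualPoint, N, directSum]
  · simp [block₂₂, dualPoint, N, directSum]

/-- Rank-nullity for the lower left block on the tangent space of `Z`. -/
theorem finrank_tangentSpace [Infinite k]
    (hcoc : ∀ C : ArrowSpace k d₁ d₂,
      (∀ ρ ∈ B.rels, ∀ x y, combDelta U C V x y (ρ x y) = 0) → C ∈ coboundaries U V)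
    (hZrep : ∀ M ∈ Z, B.IsRep M) (hZ : IsInvariant Z) (hN : directSum U V ∈ Z) :
    Module.finrank k (tangentSpace (idealOf Z) (directSum U V)) =
      Module.finrank k (tangentSpace (B.interIdeal Z) (directSum U V)) +
        Module.finrank k (coboundaries U V) := by
  let _ : ∀ a b : Δ, Fintype (a ⟶ b) := fun a b => Fintype.ofFinite _
  have hfin : Module.Finite k (ArrowSpace k (d₁ + d₂) (d₁ + d₂)) :=
    Module.Finite.equiv (arrowCoordEquiv k (d₁ + d₂) (d₁ + d₂)).symm
  set T := tangentSpace (idealOf Z) (directSum U V)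
  let τ : T →ₗ[k] ArrowSpace k d₁ d₂ := block₂₁Linear k d₁ d₂ ∘ₗ T.subtype
  have hrange : LinearMap.range τ = coboundaries U V := by
    rw [LinearMap.range_comp, Submodule.range_subtype]
    exact le_antisymm (map_tangentSpace_le_coboundaries hcoc hZrep hN)
      (coboundaries_le_map_tangentSpace hZ hN)
  have hker : (LinearMap.ker τ).map T.subtype = tangentSpace (B.interIdeal Z) (directSum U V) := by
    ext W
    rw [mem_tangentSpace_interIdeal_iff hZrep hN (isUpper_directSum U V)]
    constructor
    · rintro ⟨W, hW, rfl⟩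
      exact ⟨W.2, hW⟩
    · rintro ⟨hW, h0⟩
      exact ⟨⟨W, hW⟩, h0, rfl⟩
  have h := τ.finrank_range_add_finrank_ker
  rw [hrange, ← Submodule.finrank_map_subtype_eq T (LinearMap.ker τ), hker, add_comm] at h
  exact h.symm

end Tangent

end QuiverRep

end

theorem mainTheorem6 {k : Type u} [Field k] [IsAlgClosed k]
    {Δ : Type u} [Quiver.{u} Δ] [Fintype Δ] [∀ a b : Δ, Finite (a ⟶ b)]
    (B : QuiverRep.BoundQuiver k Δ) (d₁ d₂ : Δ → ℕ)
    (U : QuiverRep.ArrowSpace k d₁ d₁) (hU : B.IsRep U)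
    (V : QuiverRep.ArrowSpace k d₂ d₂) (hV : B.IsRep V)
    (Z : Set (QuiverRep.ArrowSpace k (d₁ + d₂) (d₁ + d₂)))
    (hZrep : ∀ M ∈ Z, B.IsRep M)
    (hZclosed : @IsClosed _ (QuiverRep.zariski k (d₁ + d₂)) Z)
    (hZirred : @IsIrreducible _ (QuiverRep.zariski k (d₁ + d₂)) Z)
    (hZinv : QuiverRep.IsInvariant Z)
    (hN : QuiverRep.directSum U V ∈ Z)
    (hExt : Subsingleton (CategoryTheory.Abelian.Ext.{u}
      (ModuleCat.of.{u} B.Alg (B.ModuleOf U hU)) (ModuleCat.of.{u} B.Alg (B.ModuleOf V hV)) 1)) :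
    QuiverRep.SmoothAt (B := QuiverRep.ProdRing (B.interIdeal Z))
        (QuiverRep.actionMap hZinv (B.idealOf_le_interIdeal Z)).toRingHom
        (QuiverRep.prodPointIdeal 1 (QuiverRep.directSum U V)
          (B.interIdeal_eval hZrep hN (QuiverRep.isUpper_directSum U V))) ∧
      IsReduced (Localization.AtPrime (QuiverRep.pointIdeal (QuiverRep.directSum U V)
        (B.interIdeal_eval hZrep hN (QuiverRep.isUpper_directSum U V)))) ∧
      Module.finrank k
          (QuiverRep.tangentSpace (QuiverRep.idealOf Z) (QuiverRep.directSum U V)) =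
        Module.finrank k
            (QuiverRep.tangentSpace (B.interIdeal Z) (QuiverRep.directSum U V)) +
          Module.finrank k (QuiverRep.coboundaries U V) := by
  -- The vanishing of `Ext¹` enters the three conclusions only in this form.
  have hcoc := fun (C : QuiverRep.ArrowSpace k d₁ d₂)
    (hC : ∀ ρ ∈ B.rels, ∀ x y, QuiverRep.combDelta U C V x y (ρ x y) = 0) =>
    QuiverRep.mem_coboundaries_of_ext hU hV hExt hC
  have hsmooth := QuiverRep.smoothAt_actionMap hcoc hZrep hZinv
    (B.interIdeal_eval hZrep hN (QuiverRep.isUpper_directSum U V))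
  exact ⟨hsmooth, QuiverRep.isReduced_localization_of_smoothAt hZinv _ _ hsmooth,
    QuiverRep.finrank_tangentSpace hcoc hZrep hZinv hN⟩
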